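/- For all constants $a\ge 0$, $d>0$ and $0<k_1\le k_2<\infty$ there is a constant $C>0$, depending only on $a,d,k_1,k_2$, such that the following holds for all integers $n\ge 4$, $p\ge 3$ and all $\alpha\in(0,e^{-1})$. Let $X_1,\dots,X_n$ be independent centered random vectors in $\mathbb R^p$ with finite second moments. Assume that the law $\mu_i$ of each $X_i$ is log-concave, i.e. $\mu_i(\lambda A_1+(1-\lambda)A_2)\ge \mu_i(A_1)^{\lambda}\mu_i(A_2)^{1-\lambda}$ for all compact $A_1,A_2\subset\mathbb R^p$ and $\lambda\in(0,1)$, and that all eigenvalues of $\mathrm E[X_iX_i']$ lie in $[k_1,k_2]$, $i=1,\dots,n$. Let $Y_1,\dots,Y_n$ be independent with $Y_i\sim N(0,\mathrm E[X_iX_i'])$ and $S_n^Y=n^{-1/2}\sum_{i=1}^nY_i$. Let $e_1,\dots,e_n$ be i.i.d. $N(0,1)$ random variables independent of $X_1^n=\{X_1,\dots,X_n\}$ and put $\bar X=n^{-1}\sum_{i=1}^nX_i$, $S_n^{eX}=n^{-1/2}\sum_{i=1}^n e_i(X_i-\bar X)$. For a class $\mathcal A$ of Borel sets let $$\rho_n^{MB}(\mathcal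 A)=\sup_{A\in\mathcal A}\bigl|\Pr(S_n^{eX}\in A\mid X_1^n)-\Pr(S_n^Y\in A)\bigr|,$$ where the conditional probabilities are taken from a regular conditional distribution of $S_n^{eX}$ given $X_1^n$. For $K\subset\mathbb R^p$ let $\mathcal S_K(v)=\sup\{w'v:w\in K\}\in[-\infty,\infty]$. A set $K$ is $m$-generated, with set of outward unit normals $\mathcal V(K)$, if $\mathcal V(K)$ is a set of $m$ unit vectors and $K=\bigcap_{v\in\mathcal V(K)}\{w:w'v\le\mathcal S_K(v)\}$; for $\epsilon\ge0$ put $K^{m,\epsilon}=\bigcap_{v\in\mathcal V(K)}\{w:w'v\le\mathcal S_K(v)+\epsilon\}$. Let $\mathcal A^{\mathrm{si}}(a,d)$ be the class of Borel sets $A\subset\mathbb R^p$ for which there is an $m$-generated set $A^m=A^m(A)$ with $m\le(pn)^d$ and $A^m\subset A\subset A^{m,\epsilon}$, $\epsilon=a/n$. Let $\mathcal A\subset\mathcal A^{\mathrm{si}}(a,d)$, and suppose that the approximating sets $A^m(A)$ and their normals $\mathcal V(A^m(A))$, $A\in\mathcal A$, are chosen so that $\bigcup_{A\in\mathcal A}\mathcal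 V(A^m(A))$ has at most $(pn)^d$ elements. Then with probability at least $1-\alpha$ (that is, on a measurable event of probability at least $1-\alpha$), $$\rho_n^{MB}(\mathcal A)\le C\,n^{-1/6}\,(\log(pn))^{5/6}\,(\log(1/\alpha))^{1/3}.$$ -/

import Mathlib

open MeasureTheory ProbabilityTheory
open scoped Pointwise

noncomputable section

/-! ### Simple convex sets -/

/-- The support function `v ↦ sup {w'v : w ∈ K}`, with values in `[-∞, ∞]`. -/
def supportFun {p : ℕ} (K : Set (EuclideanSpace ℝ (Fin p))) (v : EuclideanSpace ℝ (Fin p)) :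
    EReal :=
  ⨆ w ∈ K, ((inner ℝ w v : ℝ) : EReal)

/-- For a finite set `V` of directions, the set `⋂_{v ∈ V} {w : w'v ≤ S_K(v) + ε}`. -/
def polyhedralEnlargement {p : ℕ} (K : Set (EuclideanSpace ℝ (Fin p)))
    (V : Finset (EuclideanSpace ℝ (Fin p))) (ε : ℝ) : Set (EuclideanSpace ℝ (Fin p)) :=
  {w | ∀ v ∈ V, ((inner ℝ w v : ℝ) : EReal) ≤ supportFun K v + (ε : EReal)}

/-- `K` is the intersection of finitely many half-spaces whose outward unit normals form the finite
set `V`: `K = ⋂_{v ∈ V} {w : w'v ≤ S_K(v)}`. Thus `K` is `m`-generated with `m = #V`, and `V` is a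
set of outward unit normals of `K`. -/
structure IsGeneratedBy {p : ℕ} (K : Set (EuclideanSpace ℝ (Fin p)))
    (V : Finset (EuclideanSpace ℝ (Fin p))) : Prop where
  norm_eq_one : ∀ v ∈ V, ‖v‖ = 1
  eq_inter : K = {w | ∀ v ∈ V, ((inner ℝ w v : ℝ) : EReal) ≤ supportFun K v}

/-- `A` admits an approximation with precision `a / n` by the `m`-generated convex set `K`
with set of normals `V`, where `m = #V ≤ (p n) ^ d`: `K ⊆ A ⊆ K^{m, a / n}`. -/
structure IsSimpleApprox (p n : ℕ) (a d : ℝ) (A K : Set (EuclideanSpace ℝ (Fin p)))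
    (V : Finset (EuclideanSpace ℝ (Fin p))) : Prop where
  generated : IsGeneratedBy K V
  card_le : (V.card : ℝ) ≤ ((p : ℝ) * n) ^ d
  subset_left : K ⊆ A
  subset_right : A ⊆ polyhedralEnlargement K V (a / n)

/-- The class of simple convex sets with parameters `a`, `d`: Borel sets `A` that admit an
approximation with precision `a / n` by an `m`-generated convex set with `m ≤ (p n) ^ d`. -/
def simpleConvexSets (p n : ℕ) (a d : ℝ) : Set (Set (EuclideanSpace ℝ (Fin p))) :=
  {A | MeasurableSet A ∧ ∃ K V, IsSimpleApprox p n a d A K V}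

/-! ### Distributions -/

/-- A Borel measure on `ℝᵖ` is log-concave if
`μ (t A₁ + (1 - t) A₂) ≥ μ (A₁) ^ t * μ (A₂) ^ (1 - t)` for all compact `A₁`, `A₂` and
`t ∈ (0, 1)`. -/
def IsLogConcave {p : ℕ} (μ : Measure (EuclideanSpace ℝ (Fin p))) : Prop :=
  ∀ A₁ A₂ : Set (EuclideanSpace ℝ (Fin p)), IsCompact A₁ → IsCompact A₂ →
    ∀ t : ℝ, 0 < t → t < 1 →
      μ A₁ ^ t * μ A₂ ^ (1 - t) ≤ μ (t • A₁ + (1 - t) • A₂)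

/-- The matrix `E[Z Z']` of a random vector `Z` in `ℝᵖ`. -/
def secondMomentMatrix {p : ℕ} {Ω : Type*} [MeasurableSpace Ω] (P : Measure Ω)
    (Z : Ω → EuclideanSpace ℝ (Fin p)) : Matrix (Fin p) (Fin p) ℝ :=
  Matrix.of fun j k => ∫ ω, Z ω j * Z ω k ∂P

/-! ### Normalized sums and the multiplier bootstrap -/

/-- `n^{-1/2} ∑ᵢ Zᵢ`. -/
def normalizedSum {p n : ℕ} {Ω : Type*} (Z : Fin n → Ω → EuclideanSpace ℝ (Fin p)) (ω : Ω) :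
    EuclideanSpace ℝ (Fin p) :=
  (√(n : ℝ))⁻¹ • ∑ i, Z i ω

/-- `X̄ = n⁻¹ ∑ᵢ Xᵢ`. -/
def sampleMean {p n : ℕ} {Ω : Type*} (X : Fin n → Ω → EuclideanSpace ℝ (Fin p)) (ω : Ω) :
    EuclideanSpace ℝ (Fin p) :=
  (n : ℝ)⁻¹ • ∑ i, X i ω

/-- `n^{-1/2} ∑ᵢ eᵢ (Xᵢ - X̄)`. -/
def bootstrapSum {p n : ℕ} {Ω : Type*} (X : Fin n → Ω → EuclideanSpace ℝ (Fin p))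
    (e : Fin n → Ω → ℝ) : Ω → EuclideanSpace ℝ (Fin p) :=
  normalizedSum fun i ω => e i ω • (X i ω - sampleMean X ω)

/-- The random variable
`ρ(𝒜) = sup_{A ∈ 𝒜} |P (n^{-1/2} ∑ᵢ eᵢ (Xᵢ - X̄) ∈ A | X₁, …, Xₙ) - P' (n^{-1/2} ∑ᵢ Yᵢ ∈ A)|`, where
the conditional probability is given by the regular conditional distribution. -/
def rhoMB {p n : ℕ} {Ω Ω' : Type*} [MeasurableSpace Ω] [MeasurableSpace Ω']
    (P : Measure Ω) [IsFiniteMeasure P] (P' : Measure Ω')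
    (X : Fin n → Ω → EuclideanSpace ℝ (Fin p)) (e : Fin n → Ω → ℝ)
    (Y : Fin n → Ω' → EuclideanSpace ℝ (Fin p))
    (𝒜 : Set (Set (EuclideanSpace ℝ (Fin p)))) (ω : Ω) : ℝ :=
  ⨆ A : 𝒜, |(condDistrib (bootstrapSum X e) (fun ω i => X i ω) P (fun i => X i ω)).real
      (A : Set (EuclideanSpace ℝ (Fin p))) - P'.real {ω' | normalizedSum Y ω' ∈ A.1}|

end

/-! Conditionally on the observations, the multiplier sum is exactly a centered Gaussian vector with
the empirical covariance (`condDistrib_bootstrapSum`, `gaussian_multiplierSum`). The target is a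
centered Gaussian vector as well, so no central limit theorem is needed: two Gaussian laws have to
be compared on polytopes with at most `N = (pn)^d` facets, given that their covariances agree up to
`Δ` on all pairs of normals.

The comparison replaces the maximum of the slacks by the log-sum-exp `smoothMax`, which is off by at
most `log N / β`, and the indicator by a smooth step of width `1/φ`. Moving from one Gaussian law to
the other in many small independent increments shows that the expectation of the smoothed indicator
changes by at most a multiple of `(φ² + βφ) Δ` (`gaussian_comparison_smoothMax`); the number of
facets does not enter, because the derivatives of `smoothMax` are built from averages. Undoing the
smoothing costs `(log N / β + 1/φ)` times the anti-concentration factor of order `√(log N)` from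
Nazarov's inequality (`gaussian_antiConcentration`), applied to the target only, whose variances are
at least `k₁`. The gap `a/n` between a set and its polytope is absorbed in the same way.

It remains to bound `Δ`. Log-concavity and bounded variances give each marginal an exponential
moment by Borell's lemma (`hasExpMoment_of_isLogConcave`). Products of two marginals then have only
a stretched exponential moment of order 1/2, so the exponential Markov inequality is applied after
truncation, and a union bound over all pairs of normals yields
`measureReal_compl_empiricalMomentEvent_le`.

With `L = log(pn)` and `l = log(1/α)`, the deviation is of order `Δ = √(L/n) l`, and with `β = φL`
the error is of order `√L/φ + φ² L Δ`. Balancing the two terms gives the rate `n^{-1/6} L^{5/6}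
l^{1/3}`. Where the truncation level is too low for the tail bound, the claimed bound exceeds 1 and
nothing is to be proved. -/

open Filter
open scoped ENNReal NNReal Topology RealInnerProductSpace

set_option linter.unusedSectionVars false

/-! ### Centered Gaussian measures on Hilbert spaces and their linear combinations -/

section CenteredGaussian

variable {E F G : Type*}
  [NormedAddCommGroup E] [InnerProductSpace ℝ E] [CompleteSpace E] [SecondCountableTopology E]
  [MeasurableSpace E] [BorelSpace E]
  [NormedAddCommGroup F] [InnerProductSpace ℝ F] [CompleteSpace F] [SecondCountableTopology F]
  [MeasurableSpace F] [BorelSpace F]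
  [NormedAddCommGroup G] [InnerProductSpace ℝ G] [CompleteSpace G] [SecondCountableTopology G]
  [MeasurableSpace G] [BorelSpace G]

theorem integrable_inner_mul_inner_gaussian (μ : Measure E) [IsGaussian μ] (s t : E) :
    Integrable (fun z => ⟪s, z⟫ * ⟪t, z⟫) μ := by
  have h (s : E) : MemLp (fun z => ⟪s, z⟫) 2 μ :=
    IsGaussian.memLp_dual μ (innerSL ℝ s) 2 (by norm_num)
  exact (h s).integrable_mul (h t)

theorem integrable_inner_gaussian (μ : Measure E) [IsGaussian μ] (s : E) :
    Integrable (fun z => ⟪s, z⟫) μ :=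
  IsGaussian.integrable_dual μ (innerSL ℝ s)

theorem integrable_inner_sq_gaussian (μ : Measure E) [IsGaussian μ] (s : E) :
    Integrable (fun z => ⟪s, z⟫ ^ 2) μ := by
  simpa only [sq] using integrable_inner_mul_inner_gaussian μ s s

theorem integral_inner_eq_zero_gaussian {μ : Measure E} [IsGaussian μ] (hμ : ∫ z, z ∂μ = 0)
    (s : E) : ∫ z, ⟪s, z⟫ ∂μ = 0 := by
  rw [integral_inner IsGaussian.integrable_fun_id, hμ, inner_zero_right]

theorem covarianceBilin_eq_integral_of_centered {μ : Measure E} [IsGaussian μ]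
    (hμ : ∫ z, z ∂μ = 0) (s t : E) : covarianceBilin μ s t = ∫ z, ⟪s, z⟫ * ⟪t, z⟫ ∂μ := by
  rw [covarianceBilin_apply IsGaussian.memLp_two_id]
  simp [hμ]

/-- A centered Gaussian measure is determined by the second moments of its marginals. -/
theorem centeredGaussian_ext {μ ν : Measure E} [IsGaussian μ] [IsGaussian ν]
    (hμ : ∫ z, z ∂μ = 0) (hν : ∫ z, z ∂ν = 0)
    (h : ∀ t, ∫ z, ⟪t, z⟫ ^ 2 ∂μ = ∫ z, ⟪t, z⟫ ^ 2 ∂ν) : μ = ν := by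
  apply Measure.ext_of_charFun
  ext t
  have hv {μ : Measure E} [IsGaussian μ] (hμ : ∫ z, z ∂μ = 0) :
      Var[fun z => ⟪t, z⟫; μ] = ∫ z, ⟪t, z⟫ ^ 2 ∂μ :=
    variance_of_integral_eq_zero (integrable_inner_gaussian μ t).aemeasurable
      (integral_inner_eq_zero_gaussian hμ t)
  rw [IsGaussian.charFun_eq, IsGaussian.charFun_eq, hv hμ, hv hν, h t]
  simp only [integral_complex_ofReal, integral_inner_eq_zero_gaussian hμ,
    integral_inner_eq_zero_gaussian hν]

/-- The law of `L x + M y`, for independent `x ∼ μ` and `y ∼ ν`. -/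
noncomputable def mapAddProd (μ : Measure E) (ν : Measure F) (L : E →L[ℝ] G) (M : F →L[ℝ] G) :
    Measure G :=
  (μ.prod ν).map fun z => L z.1 + M z.2

instance isGaussian_mapAddProd (μ : Measure E) (ν : Measure F) [IsGaussian μ] [IsGaussian ν]
    (L : E →L[ℝ] G) (M : F →L[ℝ] G) : IsGaussian (mapAddProd μ ν L M) :=
  isGaussian_map (L.coprod M)

theorem integral_mapAddProd_id {μ : Measure E} {ν : Measure F} [IsGaussian μ] [IsGaussian ν]
    (hμ : ∫ z, z ∂μ = 0) (hν : ∫ z, z ∂ν = 0) (L : E →L[ℝ] G) (M : F →L[ℝ] G) :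
    ∫ z, z ∂(mapAddProd μ ν L M) = 0 := by
  have h1 : Integrable (fun z : E × F => L z.1) (μ.prod ν) :=
    (L.integrable_comp IsGaussian.integrable_id).comp_fst ν
  have h2 : Integrable (fun z : E × F => M z.2) (μ.prod ν) :=
    (M.integrable_comp IsGaussian.integrable_id).comp_snd μ
  rw [mapAddProd, integral_map (by fun_prop) (by fun_prop), integral_add h1 h2,
    integral_fun_fst (μ := μ) (ν := ν) (fun x => L x),
    integral_fun_snd (μ := μ) (ν := ν) (fun x => M x),
    L.integral_comp_comm IsGaussian.integrable_fun_id,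
    M.integral_comp_comm IsGaussian.integrable_fun_id, hμ, hν]
  simp

theorem integral_inner_sq_mapAddProd {μ : Measure E} {ν : Measure F} [IsGaussian μ]
    [IsGaussian ν] (hμ : ∫ z, z ∂μ = 0) (L : E →L[ℝ] G)
    (M : F →L[ℝ] G) (t : G) :
    ∫ z, ⟪t, z⟫ ^ 2 ∂(mapAddProd μ ν L M) =
      ∫ x, ⟪t, L x⟫ ^ 2 ∂μ + ∫ y, ⟪t, M y⟫ ^ 2 ∂ν := by
  have hL (x : E) : ⟪t, L x⟫ = ⟪L.adjoint t, x⟫ := (L.adjoint_inner_left x t).symm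
  have hM (y : F) : ⟪t, M y⟫ = ⟪M.adjoint t, y⟫ := (M.adjoint_inner_left y t).symm
  rw [mapAddProd, integral_map (by fun_prop) (by fun_prop)]
  simp_rw [inner_add_right, hL, hM, add_sq]
  have h1 := (integrable_inner_sq_gaussian μ (L.adjoint t)).comp_fst ν
  have h2 := (integrable_inner_sq_gaussian ν (M.adjoint t)).comp_snd μ
  have h3 : Integrable (fun z : E × F => 2 * ⟪L.adjoint t, z.1⟫ * ⟪M.adjoint t, z.2⟫)
      (μ.prod ν) := by
    simpa only [mul_assoc] using ((integrable_inner_gaussian μ (L.adjoint t)).mul_prod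
      (integrable_inner_gaussian ν (M.adjoint t))).const_mul 2
  have h13 : Integrable (fun z : E × F => ⟪L.adjoint t, z.1⟫ ^ 2 +
      2 * ⟪L.adjoint t, z.1⟫ * ⟪M.adjoint t, z.2⟫) (μ.prod ν) := h1.add h3
  rw [integral_add h13 h2, integral_add h1 h3]
  have h4 : ∫ z : E × F, 2 * ⟪L.adjoint t, z.1⟫ * ⟪M.adjoint t, z.2⟫ ∂(μ.prod ν) = 0 := by
    simp_rw [mul_assoc]
    rw [integral_const_mul, integral_prod_mul (fun x => ⟪L.adjoint t, x⟫)
      (fun y => ⟪M.adjoint t, y⟫), integral_inner_eq_zero_gaussian hμ]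
    simp
  rw [h4, integral_fun_fst (μ := μ) (ν := ν) (fun x => ⟪L.adjoint t, x⟫ ^ 2),
    integral_fun_snd (μ := μ) (ν := ν) (fun x => ⟪M.adjoint t, x⟫ ^ 2)]
  simp

end CenteredGaussian

/-! ### Nazarov's anti-concentration inequality -/

section AntiConcentration

variable {E : Type*} [NormedAddCommGroup E] [InnerProductSpace ℝ E] [CompleteSpace E]
  [SecondCountableTopology E] [MeasurableSpace E] [BorelSpace E]

theorem inner_covarianceOperator_gaussian (ν : Measure E) [IsGaussian ν] (u t : E) :
    ⟪covarianceOperator ν u, t⟫ = ∫ z, ⟪u, z⟫ * ⟪t, z⟫ ∂ν :=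
  covarianceOperator_inner IsGaussian.memLp_two_id u t

/-- Decomposition of a centered Gaussian vector along a functional of unit variance. -/
theorem centeredGaussian_eq_mapAddProd {ν : Measure E} [IsGaussian ν] (hν : ∫ z, z ∂ν = 0)
    {u : E} (hu : ∫ z, ⟪u, z⟫ ^ 2 ∂ν = 1) :
    ν = mapAddProd ν (gaussianReal 0 1)
      (ContinuousLinearMap.id ℝ E - (innerSL ℝ u).smulRight (covarianceOperator ν u))
      ((ContinuousLinearMap.id ℝ ℝ).smulRight (covarianceOperator ν u)) := by
  set d := covarianceOperator ν u with hd
  have h0 : ∫ z, z ∂(gaussianReal 0 1) = 0 := integral_id_gaussianReal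
  refine centeredGaussian_ext hν (integral_mapAddProd_id hν h0 _ _) fun t => ?_
  rw [integral_inner_sq_mapAddProd hν]
  have h2 : ∫ y, y ^ 2 ∂(gaussianReal 0 1) = 1 := by
    have := variance_of_integral_eq_zero (X := id) (μ := gaussianReal 0 1) aemeasurable_id h0
    rw [variance_id_gaussianReal] at this
    simpa using this.symm
  have e1 (x : E) : ⟪t, (ContinuousLinearMap.id ℝ E - (innerSL ℝ u).smulRight d) x⟫ ^ 2 =
      ⟪t, x⟫ ^ 2 - 2 * ⟪t, d⟫ * (⟪u, x⟫ * ⟪t, x⟫) + ⟪t, d⟫ ^ 2 * ⟪u, x⟫ ^ 2 := by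
    simp [inner_sub_right, inner_smul_right]
    ring
  have e2 (y : ℝ) : ⟪t, ((ContinuousLinearMap.id ℝ ℝ).smulRight d) y⟫ ^ 2 =
      ⟪t, d⟫ ^ 2 * y ^ 2 := by
    simp [inner_smul_right]
    ring
  -- Since `∫ ⟪u, z⟫ ⟪t, z⟫ = ⟪d, t⟫`, removing the component along `d` lowers the second moment by
  -- exactly `⟪t, d⟫²`, and the fresh standard normal multiple of `d` restores it.
  simp_rw [e1, e2]
  have i1 := integrable_inner_sq_gaussian ν t
  have i2 := (integrable_inner_mul_inner_gaussian ν u t).const_mul (2 * ⟪t, d⟫)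
  have i3 := (integrable_inner_sq_gaussian ν u).const_mul (⟪t, d⟫ ^ 2)
  have i12 : Integrable (fun x => ⟪t, x⟫ ^ 2 - 2 * ⟪t, d⟫ * (⟪u, x⟫ * ⟪t, x⟫)) ν := i1.sub i2
  rw [integral_add i12 i3, integral_sub i1 i2, integral_const_mul, integral_const_mul,
    integral_const_mul, hu, h2, ← inner_covarianceOperator_gaussian, ← hd, real_inner_comm t d]
  ring

/-- A Mills-ratio bound. Below `τ` the density loses at most a constant factor over an interval of
length `1/(τ+1)` to the right of `x`, so the tail has mass comparable to density times that length;
above `τ` the density itself is negligible. -/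
theorem gaussianPDF_zero_one_le {τ x : ℝ} (hτ : 0 ≤ τ) :
    gaussianPDF 0 1 x ≤ ENNReal.ofReal (5 * (τ + 1)) * gaussianReal 0 1 (Set.Ici x) +
      ENNReal.ofReal (Real.exp (-τ ^ 2 / 2)) := by
  have hs : (1 : ℝ) ≤ √(2 * Real.pi) := by
    rw [Real.one_le_sqrt]; nlinarith [Real.pi_gt_three]
  have hpdf (y : ℝ) : gaussianPDFReal 0 1 y = (√(2 * Real.pi))⁻¹ * Real.exp (-y ^ 2 / 2) := by
    simp [gaussianPDFReal]
  rcases le_or_gt τ x with hx | hx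
  · refine le_add_left (ENNReal.ofReal_le_ofReal ?_)
    rw [hpdf]
    refine (mul_le_of_le_one_left (Real.exp_pos _).le (inv_le_one_of_one_le₀ hs)).trans ?_
    gcongr
  · refine le_add_right ?_
    have hδ : 0 < τ + 1 := by linarith
    set δ := (τ + 1)⁻¹ with hδdef
    have hδ0 : 0 < δ := inv_pos.2 hδ
    have hδ1 : δ * (τ + 1) = 1 := inv_mul_cancel₀ hδ.ne'
    have key : ∀ y ∈ Set.Icc x (x + δ),
        ENNReal.ofReal (gaussianPDFReal 0 1 x * Real.exp (-(3 / 2))) ≤ gaussianPDF 0 1 y := by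
      intro y hy
      refine ENNReal.ofReal_le_ofReal ?_
      rw [hpdf, hpdf, mul_assoc, ← Real.exp_add]
      gcongr
      -- If `x + y ≤ 0` the difference is nonpositive; otherwise it is at most `δ · 2(τ+1) = 2`. The
      -- factor 5 in the statement is a bound for `exp (3/2)`.
      have h1 : y ^ 2 - x ^ 2 ≤ 3 := by
        have : (y - x) * (y + x) ≤ 3 := by
          rcases le_total (y + x) 0 with h | h
          · nlinarith [hy.1]
          · have : (y - x) * (y + x) ≤ δ * (2 * (τ + 1)) := by
              have : δ ≤ 1 := by nlinarith
              apply mul_le_mul <;> linarith [hy.1, hy.2]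
            nlinarith
        nlinarith
      linarith
    have h2 : ENNReal.ofReal (gaussianPDFReal 0 1 x * Real.exp (-(3 / 2))) * ENNReal.ofReal δ ≤
        gaussianReal 0 1 (Set.Ici x) := by
      calc _ = ∫⁻ _ in Set.Icc x (x + δ),
            ENNReal.ofReal (gaussianPDFReal 0 1 x * Real.exp (-(3 / 2))) := by
            simp [Real.volume_Icc]
        _ ≤ ∫⁻ y in Set.Icc x (x + δ), gaussianPDF 0 1 y :=
            setLIntegral_mono (measurable_gaussianPDF 0 1) key
        _ = gaussianReal 0 1 (Set.Icc x (x + δ)) := by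
            rw [gaussianReal_apply 0 one_ne_zero]
        _ ≤ _ := measure_mono Set.Icc_subset_Ici_self
    refine le_trans ?_ (mul_le_mul_right h2 _)
    rw [← ENNReal.ofReal_mul (by positivity [gaussianPDFReal_nonneg 0 1 x]),
      ← ENNReal.ofReal_mul (by positivity), gaussianPDF]
    refine ENNReal.ofReal_le_ofReal ?_
    have h3 : (1 : ℝ) ≤ 5 * Real.exp (-(3 / 2)) := by
      have : Real.exp (3 / 2) ≤ 5 := by
        have h := Real.exp_one_lt_d9
        have h' : Real.exp (3 / 2) ^ 2 = Real.exp 1 ^ 3 := by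
          rw [← Real.exp_nat_mul, ← Real.exp_nat_mul]; norm_num
        have : Real.exp 1 ^ 3 ≤ 2.72 ^ 3 := by gcongr; linarith
        nlinarith [Real.exp_pos (3 / 2)]
      rw [Real.exp_neg, ← div_eq_mul_inv, le_div_iff₀ (Real.exp_pos _)]
      linarith
    calc gaussianPDFReal 0 1 x ≤ gaussianPDFReal 0 1 x * (5 * Real.exp (-(3 / 2))) :=
          le_mul_of_one_le_right (gaussianPDFReal_nonneg 0 1 x) h3
      _ = _ := by linear_combination -(5 * gaussianPDFReal 0 1 x * Real.exp (-(3 / 2))) * hδ1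

/-- A point `x` of an upper set `I` has `[x, ∞) ⊆ I`, so the density at `x` is controlled by the
mass of `I` itself. Keeping this mass as a factor lets the bounds for disjoint events be summed
without a factor for their number. -/
theorem gaussianReal_upperSet_inter_Ioc_le {τ b ε : ℝ} (hτ : 0 ≤ τ) {I : Set ℝ}
    (hI : IsUpperSet I) :
    gaussianReal 0 1 (I ∩ Set.Ioc b (b + ε)) ≤ ENNReal.ofReal ε *
      (ENNReal.ofReal (5 * (τ + 1)) * gaussianReal 0 1 I +
        ENNReal.ofReal (Real.exp (-τ ^ 2 / 2))) := by
  rw [gaussianReal_apply 0 one_ne_zero]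
  calc _ ≤ ∫⁻ _ in I ∩ Set.Ioc b (b + ε), (ENNReal.ofReal (5 * (τ + 1)) * gaussianReal 0 1 I +
        ENNReal.ofReal (Real.exp (-τ ^ 2 / 2))) := by
        refine setLIntegral_mono measurable_const fun x hx => ?_
        refine (gaussianPDF_zero_one_le hτ).trans ?_
        gcongr
        exact fun y hy => hI hy hx.1
    _ ≤ _ := by
        rw [setLIntegral_const, mul_comm]
        gcongr
        refine (measure_mono Set.inter_subset_right).trans ?_
        simp [Real.volume_Ioc]

/-- The set where the maximum of the functions `f j` is attained at `j` and not before. -/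
def argmaxSet {α ι : Type*} [LinearOrder ι] (f : ι → α → ℝ) (j : ι) : Set α :=
  {z | (∀ k, f k z ≤ f j z) ∧ ∀ k < j, f k z < f j z}

theorem measurableSet_argmaxSet {α ι : Type*} [MeasurableSpace α] [LinearOrder ι] [Countable ι]
    {f : ι → α → ℝ} (hf : ∀ j, Measurable (f j)) (j : ι) : MeasurableSet (argmaxSet f j) := by
  refine MeasurableSet.inter (s₁ := {z | ∀ k, f k z ≤ f j z})
    (s₂ := {z | ∀ k < j, f k z < f j z}) ?_ ?_
  · rw [Set.ofPred_forall]
    exact .iInter fun k => measurableSet_le (hf k) (hf j)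
  · simp_rw [Set.ofPred_forall]
    exact .iInter fun k => .iInter fun _ => measurableSet_lt (hf k) (hf j)

theorem pairwise_disjoint_argmaxSet {α ι : Type*} [LinearOrder ι] (f : ι → α → ℝ) :
    Pairwise (Function.onFun Disjoint (argmaxSet f)) := by
  intro j k hjk
  refine Set.disjoint_left.2 fun z hj hk => ?_
  rcases lt_or_gt_of_ne hjk with h | h
  · exact (hk.2 j h).not_ge (hj.1 k)
  · exact (hj.2 k h).not_ge (hk.1 j)

theorem exists_mem_argmaxSet {α ι : Type*} [LinearOrder ι] [Finite ι] [Nonempty ι]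
    (f : ι → α → ℝ) (z : α) : ∃ j, z ∈ argmaxSet f j := by
  classical
  have := Fintype.ofFinite ι
  obtain ⟨j₀, hj₀⟩ := Finite.exists_max fun j => f j z
  let s := Finset.univ.filter fun j => ∀ k, f k z ≤ f j z
  have hs : s.Nonempty := ⟨j₀, by simpa [s] using hj₀⟩
  have hm := s.min'_mem hs
  have hm' : ∀ k, f k z ≤ f (s.min' hs) z := by simpa [s] using hm
  refine ⟨s.min' hs, hm', fun k hk => lt_of_le_of_ne (hm' k) fun he => ?_⟩
  exact absurd (s.min'_le k (by simpa [s, he] using hm')) (not_le.2 hk)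

/-- **Nazarov's inequality**: anti-concentration of the maximum of a Gaussian vector. -/
theorem gaussian_antiConcentration {ν : Measure E} [IsGaussian ν] (hν : ∫ z, z ∂ν = 0)
    {ι : Type*} [Fintype ι] [LinearOrder ι] {u : ι → E} (hu : ∀ j, ∫ z, ⟪u j, z⟫ ^ 2 ∂ν = 1)
    (b : ι → ℝ) {ε τ : ℝ} (hε : 0 ≤ ε) (hτ : 0 ≤ τ) :
    ν.real {z | ∀ j, ⟪u j, z⟫ ≤ b j + ε} ≤ ν.real {z | ∀ j, ⟪u j, z⟫ ≤ b j} +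
      ε * (5 * (τ + 1) + Fintype.card ι * Real.exp (-τ ^ 2 / 2)) := by
  set f : ι → E → ℝ := fun j z => ⟪u j, z⟫ - b j with hf
  have hfm (j : ι) : Measurable (f j) := by simp only [hf]; fun_prop
  set D : Set E := {z | (∀ j, ⟪u j, z⟫ ≤ b j + ε) ∧ ¬ ∀ j, ⟪u j, z⟫ ≤ b j} with hD
  have hDj (j : ι) : ν (D ∩ argmaxSet f j) ≤ ENNReal.ofReal ε *
      (ENNReal.ofReal (5 * (τ + 1)) * ν (argmaxSet f j) +
        ENNReal.ofReal (Real.exp (-τ ^ 2 / 2))) := by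
    set d := covarianceOperator ν (u j) with hd
    have hud : ⟪u j, d⟫ = 1 := by
      rw [real_inner_comm, hd, inner_covarianceOperator_gaussian, ← hu j]
      simp_rw [sq]
    -- With unit variances every covariance is at most 1. Hence a shift along `d` raises the `j`-th
    -- functional at least as fast as any other, so `j` stays the maximizer: the section of the
    -- argmax set is an upper set.
    have hkd (k : ι) : ⟪u k, d⟫ ≤ 1 := by
      have h0 : 0 ≤ ∫ z, (⟪u j, z⟫ - ⟪u k, z⟫) ^ 2 ∂ν := integral_nonneg fun z => sq_nonneg _
      have i1 := integrable_inner_sq_gaussian ν (u j)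
      have i2 := (integrable_inner_mul_inner_gaussian ν (u j) (u k)).const_mul 2
      have i3 := integrable_inner_sq_gaussian ν (u k)
      simp_rw [sub_sq, mul_assoc] at h0
      have i12 : Integrable (fun x => ⟪u j, x⟫ ^ 2 - 2 * (⟪u j, x⟫ * ⟪u k, x⟫)) ν := i1.sub i2
      rw [integral_add i12 i3, integral_sub i1 i2, integral_const_mul, hu, hu,
        ← inner_covarianceOperator_gaussian, ← hd, real_inner_comm] at h0
      linarith
    set T : E × ℝ → E := fun z => (z.1 - ⟪u j, z.1⟫ • d) + z.2 • d with hT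
    have hTm : Measurable T := by simp only [hT]; fun_prop
    have hmap : ν = (ν.prod (gaussianReal 0 1)).map T := by
      have := centeredGaussian_eq_mapAddProd hν (hu j)
      rw [mapAddProd] at this
      simpa [← hd] using this
    have hQm := measurableSet_argmaxSet hfm j
    set U : Set E := {z | b j < ⟪u j, z⟫ ∧ ⟪u j, z⟫ ≤ b j + ε} with hU
    have hUm : MeasurableSet U :=
      (measurableSet_lt (f := fun _ => b j) (g := fun z => ⟪u j, z⟫) (by fun_prop)
        (by fun_prop)).inter
      (measurableSet_le (f := fun z => ⟪u j, z⟫) (g := fun _ => b j + ε) (by fun_prop)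
        (by fun_prop))
    have hsub : D ∩ argmaxSet f j ⊆ argmaxSet f j ∩ U := by
      rintro z ⟨⟨h1, h2⟩, h3⟩
      refine ⟨h3, ?_, h1 j⟩
      by_contra! h
      refine h2 fun k => ?_
      have := h3.1 k
      simp only [hf] at this
      linarith
    -- The real coordinate of `T` is the value of the `j`-th functional, independent of the
    -- remaining component `w`.
    have hsec (w : E) (x : ℝ) : ⟪u j, T (w, x)⟫ = x := by
      simp [hT, inner_add_right, inner_sub_right, inner_smul_right, hud]
    have hup (w : E) : IsUpperSet {x : ℝ | T (w, x) ∈ argmaxSet f j} := by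
      intro x y hxy hx
      have hf' (k : ι) : f k (T (w, y)) = f k (T (w, x)) + (y - x) * ⟪u k, d⟫ := by
        simp only [hf, hT, inner_add_right, inner_smul_right]
        ring
      have hjj := hf' j
      rw [hud] at hjj
      have hk (k : ι) : f k (T (w, y)) ≤ f k (T (w, x)) + (y - x) := by
        rw [hf' k]
        nlinarith [hkd k]
      exact ⟨fun k => by linarith [hk k, hx.1 k], fun k hkj => by linarith [hk k, hx.2 k hkj]⟩
    have hsec' (w : E) : {x : ℝ | T (w, x) ∈ argmaxSet f j ∩ U} =
        {x : ℝ | T (w, x) ∈ argmaxSet f j} ∩ Set.Ioc (b j) (b j + ε) := by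
      ext x
      simp [hU, hsec]
    calc ν (D ∩ argmaxSet f j) ≤ ν (argmaxSet f j ∩ U) := measure_mono hsub
      _ = ∫⁻ w, gaussianReal 0 1 {x : ℝ | T (w, x) ∈ argmaxSet f j ∩ U} ∂ν := by
          conv_lhs => rw [hmap]
          rw [Measure.map_apply hTm (hQm.inter hUm),
            Measure.prod_apply (hTm (hQm.inter hUm))]
          rfl
      _ ≤ ∫⁻ w, ENNReal.ofReal ε * (ENNReal.ofReal (5 * (τ + 1)) *
            gaussianReal 0 1 {x : ℝ | T (w, x) ∈ argmaxSet f j} +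
              ENNReal.ofReal (Real.exp (-τ ^ 2 / 2))) ∂ν := by
          refine lintegral_mono fun w => ?_
          rw [hsec' w]
          exact gaussianReal_upperSet_inter_Ioc_le hτ (hup w)
      _ = _ := by
          have hm : Measurable fun w => gaussianReal 0 1 {x : ℝ | T (w, x) ∈ argmaxSet f j} :=
            measurable_measure_prodMk_left (hTm hQm)
          rw [lintegral_const_mul _ (by fun_prop), lintegral_add_right _ measurable_const,
            lintegral_const_mul _ hm, lintegral_const, measure_univ, mul_one]
          congr 3
          conv_rhs => rw [hmap]
          rw [Measure.map_apply hTm hQm, Measure.prod_apply (hTm hQm)]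
          rfl
  have hDle : ν D ≤ ENNReal.ofReal
      (ε * (5 * (τ + 1) + Fintype.card ι * Real.exp (-τ ^ 2 / 2))) := by
    have hsub : D ⊆ ⋃ j, D ∩ argmaxSet f j := by
      intro z hz
      have : Nonempty ι := by
        by_contra h
        rw [not_nonempty_iff] at h
        exact hz.2 fun j => h.elim j
      obtain ⟨j, hj⟩ := exists_mem_argmaxSet f z
      exact Set.mem_iUnion.2 ⟨j, hz, hj⟩
    calc ν D ≤ ∑ j, ν (D ∩ argmaxSet f j) :=
          (measure_mono hsub).trans (measure_iUnion_fintype_le ν _)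
      _ ≤ ∑ j, ENNReal.ofReal ε * (ENNReal.ofReal (5 * (τ + 1)) * ν (argmaxSet f j) +
        ENNReal.ofReal (Real.exp (-τ ^ 2 / 2))) := Finset.sum_le_sum fun j _ => hDj j
      _ = ENNReal.ofReal ε * (ENNReal.ofReal (5 * (τ + 1)) * ∑ j, ν (argmaxSet f j) +
        Fintype.card ι * ENNReal.ofReal (Real.exp (-τ ^ 2 / 2))) := by
          rw [← Finset.mul_sum, Finset.sum_add_distrib, ← Finset.mul_sum]
          simp
      -- The argmax sets are disjoint, so only the exponentially small term picks up the number of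
      -- indices.
      _ ≤ ENNReal.ofReal ε * (ENNReal.ofReal (5 * (τ + 1)) * 1 +
        Fintype.card ι * ENNReal.ofReal (Real.exp (-τ ^ 2 / 2))) := by
          gcongr
          rw [← tsum_fintype (L := .unconditional _), ← measure_iUnion (pairwise_disjoint_argmaxSet f)
            (measurableSet_argmaxSet hfm)]
          exact prob_le_one
      _ = _ := by
          rw [ENNReal.ofReal_mul hε, ENNReal.ofReal_add (by positivity) (by positivity),
            ENNReal.ofReal_mul (p := (Fintype.card ι : ℝ)) (by positivity), mul_one,
            ENNReal.ofReal_natCast]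
  have hcover : {z | ∀ j, ⟪u j, z⟫ ≤ b j + ε} ⊆ {z | ∀ j, ⟪u j, z⟫ ≤ b j} ∪ D := by
    intro z hz
    by_cases h : ∀ j, ⟪u j, z⟫ ≤ b j
    · exact Or.inl h
    · exact Or.inr ⟨hz, h⟩
  refine (measureReal_mono hcover).trans ((measureReal_union_le _ _).trans ?_)
  gcongr
  exact ENNReal.toReal_le_of_le_ofReal (by positivity) hDle

end AntiConcentration

/-! ### The log-sum-exp approximation of the maximum -/

section SmoothMax

variable {ι : Type*} [Fintype ι] [Nonempty ι]

/-- The smooth maximum `β⁻¹ log ∑ⱼ exp (β aⱼ)`. -/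
noncomputable def smoothMax (β : ℝ) (a : ι → ℝ) : ℝ := β⁻¹ * Real.log (∑ j, Real.exp (β * a j))

/-- The average of `f` with weights proportional to `exp (β aⱼ)`. -/
noncomputable def gibbsAverage (β : ℝ) (a f : ι → ℝ) : ℝ :=
  (∑ j, f j * Real.exp (β * a j)) / ∑ j, Real.exp (β * a j)

theorem sum_exp_pos (β : ℝ) (a : ι → ℝ) : 0 < ∑ j, Real.exp (β * a j) :=
  Finset.sum_pos (fun _ _ => Real.exp_pos _) Finset.univ_nonempty

/-- The weights are positive and sum to one. This is why no power of the number of facets enters the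
comparison of expectations. -/
theorem abs_gibbsAverage_le (β : ℝ) (a : ι → ℝ) {f : ι → ℝ} {c : ℝ} (h : ∀ j, |f j| ≤ c) :
    |gibbsAverage β a f| ≤ c := by
  rw [gibbsAverage, abs_div, abs_of_pos (sum_exp_pos β a), div_le_iff₀ (sum_exp_pos β a),
    Finset.mul_sum]
  refine (Finset.abs_sum_le_sum_abs _ _).trans (Finset.sum_le_sum fun j _ => ?_)
  rw [abs_mul, Real.abs_exp]
  exact mul_le_mul_of_nonneg_right (h j) (Real.exp_pos _).le

theorem gibbsAverage_sub (β : ℝ) (a f g : ι → ℝ) :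
    gibbsAverage β a (fun j => f j - g j) = gibbsAverage β a f - gibbsAverage β a g := by
  simp_rw [gibbsAverage, sub_mul, Finset.sum_sub_distrib, sub_div]

theorem gibbsAverage_const_mul (β : ℝ) (a f : ι → ℝ) (c : ℝ) :
    gibbsAverage β a (fun j => c * f j) = c * gibbsAverage β a f := by
  simp_rw [gibbsAverage, mul_assoc, ← Finset.mul_sum, mul_div_assoc]

/-- Unfolding the square into products `f j * f k` lets integration reach the entries of the
covariance matrix. -/
theorem gibbsAverage_sq (β : ℝ) (a f : ι → ℝ) :
    gibbsAverage β a f ^ 2 = gibbsAverage β a fun j => gibbsAverage β a fun k => f j * f k := by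
  have (j : ι) : (gibbsAverage β a fun k => f j * f k) = gibbsAverage β a f * f j := by
    rw [gibbsAverage_const_mul, mul_comm]
  simp_rw [this, gibbsAverage_const_mul, sq]

theorem integrable_gibbsAverage {α : Type*} [MeasurableSpace α] {μ : Measure α} (β : ℝ)
    (a : ι → ℝ) {f : α → ι → ℝ} (hf : ∀ j, Integrable (fun x => f x j) μ) :
    Integrable (fun x => gibbsAverage β a (f x)) μ :=
  (integrable_finsetSum _ fun j _ => (hf j).mul_const _).div_const _

theorem integral_gibbsAverage {α : Type*} [MeasurableSpace α] {μ : Measure α} (β : ℝ)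
    (a : ι → ℝ) {f : α → ι → ℝ} (hf : ∀ j, Integrable (fun x => f x j) μ) :
    ∫ x, gibbsAverage β a (f x) ∂μ = gibbsAverage β a fun j => ∫ x, f x j ∂μ := by
  simp_rw [gibbsAverage]
  rw [integral_div, integral_finsetSum _ fun j _ => (hf j).mul_const _]
  simp_rw [integral_mul_const]

theorem hasDerivAt_sum_mul_exp (β : ℝ) (a x f : ι → ℝ) (t : ℝ) :
    HasDerivAt (fun t => ∑ j, f j * Real.exp (β * (a j + t * x j)))
      (β * ∑ j, (f j * x j) * Real.exp (β * (a j + t * x j))) t := by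
  rw [Finset.mul_sum]
  refine HasDerivAt.fun_sum fun j _ => ?_
  have h := (((((hasDerivAt_id t).mul_const (x j)).const_add (a j)).const_mul β).exp).const_mul
    (f j)
  refine h.congr_deriv ?_
  simp only [id]
  ring

/-- Differentiating a Gibbs weight produces `β` times a covariance under the weights. The
derivatives are again built from averages, so the formula can be iterated. -/
theorem hasDerivAt_gibbsAverage (β : ℝ) (a x f : ι → ℝ) (t : ℝ) :
    HasDerivAt (fun t => gibbsAverage β (fun j => a j + t * x j) f)
      (β * (gibbsAverage β (fun j => a j + t * x j) (fun j => f j * x j) -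
        gibbsAverage β (fun j => a j + t * x j) f * gibbsAverage β (fun j => a j + t * x j) x))
      t := by
  have h0 := sum_exp_pos β fun j => a j + t * x j
  have h1 := hasDerivAt_sum_mul_exp β a x f t
  have h2 := hasDerivAt_sum_mul_exp β a x (fun _ => 1) t
  simp only [one_mul] at h2
  have h := h1.fun_div h2 h0.ne'
  refine h.congr_deriv ?_
  simp only [gibbsAverage]
  generalize (∑ j, Real.exp (β * (a j + t * x j))) = S at h0 ⊢
  generalize (∑ j, f j * Real.exp (β * (a j + t * x j))) = A
  generalize (∑ j, x j * Real.exp (β * (a j + t * x j))) = B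
  generalize (∑ j, f j * x j * Real.exp (β * (a j + t * x j))) = D
  field_simp

theorem hasDerivAt_smoothMax {β : ℝ} (hβ : β ≠ 0) (a x : ι → ℝ) (t : ℝ) :
    HasDerivAt (fun t => smoothMax β (fun j => a j + t * x j))
      (gibbsAverage β (fun j => a j + t * x j) x) t := by
  have h0 := sum_exp_pos β fun j => a j + t * x j
  have h2 := hasDerivAt_sum_mul_exp β a x (fun _ => 1) t
  simp only [one_mul] at h2
  refine ((h2.log h0.ne').const_mul β⁻¹).congr_deriv ?_
  simp only [gibbsAverage]
  generalize (∑ j, Real.exp (β * (a j + t * x j))) = S at h0 ⊢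
  generalize (∑ j, x j * Real.exp (β * (a j + t * x j))) = B
  field_simp

theorem le_smoothMax {β : ℝ} (hβ : 0 < β) (a : ι → ℝ) (j : ι) : a j ≤ smoothMax β a := by
  rw [smoothMax, inv_mul_eq_div, le_div_iff₀ hβ, Real.le_log_iff_exp_le (sum_exp_pos β a),
    mul_comm]
  exact Finset.single_le_sum (f := fun j => Real.exp (β * a j)) (fun _ _ => (Real.exp_pos _).le)
    (Finset.mem_univ j)

theorem smoothMax_le {β : ℝ} (hβ : 0 < β) {a : ι → ℝ} {c : ℝ} (h : ∀ j, a j ≤ c) :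
    smoothMax β a ≤ c + Real.log (Fintype.card ι) / β := by
  rw [smoothMax, inv_mul_eq_div, div_le_iff₀ hβ, add_mul, div_mul_cancel₀ _ hβ.ne',
    Real.log_le_iff_le_exp (sum_exp_pos β a), Real.exp_add (c * β), Real.exp_log (by positivity)]
  calc ∑ j, Real.exp (β * a j) ≤ ∑ _j : ι, Real.exp (c * β) := by
        refine Finset.sum_le_sum fun j _ => Real.exp_le_exp.2 ?_
        rw [mul_comm]
        exact mul_le_mul_of_nonneg_right (h j) hβ.le
    _ = _ := by simp [mul_comm]

theorem continuous_smoothMax (β : ℝ) : Continuous (smoothMax β : (ι → ℝ) → ℝ) := by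
  unfold smoothMax
  refine continuous_const.mul (Continuous.log (by fun_prop) fun a => (sum_exp_pos β a).ne')

end SmoothMax

/-- Second order Taylor expansion on `[0, 1]`. -/
theorem abs_taylor_two_le {f f₁ f₂ f₃ : ℝ → ℝ} {K : ℝ} (h₁ : ∀ t, HasDerivAt f (f₁ t) t)
    (h₂ : ∀ t, HasDerivAt f₁ (f₂ t) t) (h₃ : ∀ t, HasDerivAt f₂ (f₃ t) t)
    (hK : ∀ t, |f₃ t| ≤ K) : |f 1 - f 0 - f₁ 0 - f₂ 0 / 2| ≤ K := by
  have hK0 : 0 ≤ K := (abs_nonneg _).trans (hK 0)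
  have mv {g g' : ℝ → ℝ} (hg : ∀ t, HasDerivAt g (g' t) t)
      (hb : ∀ t ∈ Set.Icc (0 : ℝ) 1, |g' t| ≤ K) : ∀ t ∈ Set.Icc (0 : ℝ) 1, |g t - g 0| ≤ K := by
    intro t ht
    have := (convex_Icc (0 : ℝ) 1).norm_image_sub_le_of_norm_hasDerivWithin_le
      (fun x _ => (hg x).hasDerivWithinAt) hb (Set.left_mem_Icc.2 zero_le_one) ht
    simp only [Real.norm_eq_abs, sub_zero] at this
    refine this.trans (mul_le_of_le_one_right hK0 ?_)
    rw [abs_of_nonneg ht.1]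
    exact ht.2
  have s₂ := mv h₃ fun t _ => hK t
  -- The mean value inequality is applied once per order. The lost factor 1/6 is harmless, since the
  -- remainder vanishes in the limit of small increments.
  have s₁ := mv (g := fun t => f₁ t - t * f₂ 0) (g' := fun t => f₂ t - f₂ 0)
    (fun t => ((h₂ t).fun_sub ((hasDerivAt_id t).mul_const (f₂ 0))).congr_deriv (by simp)) s₂
  simp only [zero_mul, sub_zero] at s₁
  have s₀ := mv (g := fun t => f t - t * f₁ 0 - t ^ 2 / 2 * f₂ 0)
    (g' := fun t => f₁ t - t * f₂ 0 - f₁ 0)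
    (fun t => (((h₁ t).fun_sub ((hasDerivAt_id t).mul_const (f₁ 0))).fun_sub
      ((((hasDerivAt_id t).fun_pow 2).div_const 2).mul_const (f₂ 0))).congr_deriv (by
        simp
        ring)) s₁ 1 (Set.right_mem_Icc.2 zero_le_one)
  convert s₀ using 2
  simp
  ring

/-- A function with three derivatives given by `G₁, G₂, G₃`, bounded by `B₁, B₂, B₃`. -/
structure HasBoundedDerivs (G G₁ G₂ G₃ : ℝ → ℝ) (B₁ B₂ B₃ : ℝ) : Prop where
  deriv₁ : ∀ x, HasDerivAt G (G₁ x) x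
  deriv₂ : ∀ x, HasDerivAt G₁ (G₂ x) x
  deriv₃ : ∀ x, HasDerivAt G₂ (G₃ x) x
  bound₁ : ∀ x, |G₁ x| ≤ B₁
  bound₂ : ∀ x, |G₂ x| ≤ B₂
  bound₃ : ∀ x, |G₃ x| ≤ B₃

/-! ### Expansion of a smooth function of the smooth maximum -/

section Taylor

variable {ι : Type*} [Fintype ι] [Nonempty ι]

/-- Second derivative in the direction `x` of `G ∘ smoothMax β` at `a`. -/
noncomputable def smoothMaxHess (G₁ G₂ : ℝ → ℝ) (β : ℝ) (a x : ι → ℝ) : ℝ :=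
  G₂ (smoothMax β a) * gibbsAverage β a x ^ 2 + G₁ (smoothMax β a) *
    (β * (gibbsAverage β a (fun j => x j * x j) - gibbsAverage β a x ^ 2))

/-- The first three derivatives of `smoothMax` along `x` are the mean, `β` times the variance and
`β²` times the third cumulant of `x` under the Gibbs weights; their sizes `r`, `2βr²` and `6β²r³`
give the constants through the chain rule. -/
theorem abs_comp_smoothMax_taylor_le {G G₁ G₂ G₃ : ℝ → ℝ} {B₁ B₂ B₃ β r : ℝ}
    (hG : HasBoundedDerivs G G₁ G₂ G₃ B₁ B₂ B₃) (hβ : 0 < β) (a : ι → ℝ) {x : ι → ℝ}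
    (hx : ∀ j, |x j| ≤ r) :
    |G (smoothMax β fun j => a j + x j) - G (smoothMax β a) -
      G₁ (smoothMax β a) * gibbsAverage β a x - smoothMaxHess G₁ G₂ β a x / 2| ≤
      (B₃ + 6 * β * B₂ + 6 * β ^ 2 * B₁) * r ^ 3 := by
  let A : ℝ → ι → ℝ := fun t j => a j + t * x j
  have hF (t : ℝ) : HasDerivAt (fun t => smoothMax β (A t)) (gibbsAverage β (A t) x) t :=
    hasDerivAt_smoothMax hβ.ne' a x t
  have hg (f : ι → ℝ) (t : ℝ) : HasDerivAt (fun t => gibbsAverage β (A t) f)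
      (β * (gibbsAverage β (A t) (fun j => f j * x j) -
        gibbsAverage β (A t) f * gibbsAverage β (A t) x)) t := hasDerivAt_gibbsAverage β a x f t
  have h₁ (t : ℝ) := (hG.deriv₁ (smoothMax β (A t))).comp t (hF t)
  have h₂ (t : ℝ) := ((hG.deriv₂ (smoothMax β (A t))).comp t (hF t)).fun_mul (hg x t)
  have h₃ (t : ℝ) := (((hG.deriv₃ (smoothMax β (A t))).comp t (hF t)).fun_mul
    ((hg x t).fun_pow 2)).fun_add (((hG.deriv₂ (smoothMax β (A t))).comp t (hF t)).fun_mul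
      (((hg (fun j => x j * x j) t).fun_sub ((hg x t).fun_pow 2)).const_mul β))
  have h := abs_taylor_two_le (f := fun t => G (smoothMax β (A t)))
    (f₁ := fun t => G₁ (smoothMax β (A t)) * gibbsAverage β (A t) x)
    (f₂ := fun t => smoothMaxHess G₁ G₂ β (A t) x) h₁
    (K := (B₃ + 6 * β * B₂ + 6 * β ^ 2 * B₁) * r ^ 3)
    (fun t => (h₂ t).congr_deriv (by
      simp only [smoothMaxHess, Function.comp_apply]
      ring)) h₃ ?_
  · simpa [A] using h
  · intro t
    set F := smoothMax β (A t)
    set g₁ := gibbsAverage β (A t) x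
    set g₂ := gibbsAverage β (A t) fun j => x j * x j
    set g₃ := gibbsAverage β (A t) fun j => x j * x j * x j
    have hr : 0 ≤ r := (abs_nonneg _).trans (hx (Classical.arbitrary ι))
    have b₁ : |g₁| ≤ r := abs_gibbsAverage_le _ _ hx
    have b₂ : |g₂| ≤ r * r := abs_gibbsAverage_le _ _ fun j => by
      rw [abs_mul]; gcongr <;> exact hx j
    have b₃ : |g₃| ≤ r * r * r := abs_gibbsAverage_le _ _ fun j => by
      rw [abs_mul, abs_mul]; gcongr <;> exact hx j
    have hB₁ := hG.bound₁ F
    have hB₂ := hG.bound₂ F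
    have hB₃ := hG.bound₃ F
    have p₁ : 0 ≤ B₁ := (abs_nonneg _).trans hB₁
    have p₂ : 0 ≤ B₂ := (abs_nonneg _).trans hB₂
    have p₃ : 0 ≤ B₃ := (abs_nonneg _).trans hB₃
    have c₂ : |g₂ - g₁ ^ 2| ≤ 2 * r ^ 2 := by
      refine (abs_sub _ _).trans ?_
      rw [abs_pow]
      nlinarith [pow_le_pow_left₀ (abs_nonneg _) b₁ 2]
    have c₃ : |g₃ - g₂ * g₁ - 2 * g₁ * (g₂ - g₁ ^ 2)| ≤ 6 * r ^ 3 := by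
      have e₁ : |g₂ * g₁| ≤ r * r * r := by rw [abs_mul]; gcongr
      have e₂ : |2 * g₁ * (g₂ - g₁ ^ 2)| ≤ 2 * r * (2 * r ^ 2) := by
        rw [abs_mul, abs_mul, abs_two]; gcongr
      have := abs_sub (g₃ - g₂ * g₁) (2 * g₁ * (g₂ - g₁ ^ 2))
      have := abs_sub g₃ (g₂ * g₁)
      nlinarith
    calc _ = |G₃ F * g₁ ^ 3 + 3 * β * (G₂ F * (g₁ * (g₂ - g₁ ^ 2))) +
          β ^ 2 * (G₁ F * (g₃ - g₂ * g₁ - 2 * g₁ * (g₂ - g₁ ^ 2)))| := by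
          congr 1
          simp only [Function.comp_apply]
          ring
      _ ≤ B₃ * r ^ 3 + 3 * β * (B₂ * (r * (2 * r ^ 2))) + β ^ 2 * (B₁ * (6 * r ^ 3)) := by
          refine (abs_add_le _ _).trans (add_le_add ((abs_add_le _ _).trans (add_le_add ?_ ?_)) ?_)
          · rw [abs_mul, abs_pow]; gcongr
          · rw [abs_mul, abs_of_pos (by positivity : 0 < 3 * β), abs_mul, abs_mul]; gcongr
          · rw [abs_mul, abs_mul, abs_of_pos (by positivity : 0 < β ^ 2)]; gcongr
      _ = _ := by ring

end Taylor

/-! ### Gaussian comparison by small independent increments -/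

section Comparison

variable {E : Type*} [NormedAddCommGroup E] [InnerProductSpace ℝ E] [CompleteSpace E]
  [SecondCountableTopology E] [MeasurableSpace E] [BorelSpace E]
  {ι : Type*} [Fintype ι] [Nonempty ι]

theorem integrable_norm_pow_gaussian (μ : Measure E) [IsGaussian μ] :
    Integrable (fun z => ‖z‖ ^ 3) μ :=
  (IsGaussian.memLp_id μ 3 (by norm_num)).integrable_norm_pow (p := 3) (by norm_num)

/-- The expectation of `smoothMaxHess` under a centered Gaussian measure. -/
theorem integral_smoothMaxHess (μ : Measure E) [IsGaussian μ] (v : ι → E) (G₁ G₂ : ℝ → ℝ) (β : ℝ)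
    (a : ι → ℝ) :
    Integrable (fun z => smoothMaxHess G₁ G₂ β a fun j => ⟪v j, z⟫) μ ∧
    ∫ z, smoothMaxHess G₁ G₂ β a (fun j => ⟪v j, z⟫) ∂μ =
      G₂ (smoothMax β a) *
        (gibbsAverage β a fun j => gibbsAverage β a fun k => ∫ z, ⟪v j, z⟫ * ⟪v k, z⟫ ∂μ) +
      G₁ (smoothMax β a) * (β * ((gibbsAverage β a fun j => ∫ z, ⟪v j, z⟫ * ⟪v j, z⟫ ∂μ) -
        gibbsAverage β a fun j => gibbsAverage β a fun k => ∫ z, ⟪v j, z⟫ * ⟪v k, z⟫ ∂μ)) := by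
  have i0 (j k : ι) := integrable_inner_mul_inner_gaussian μ (v j) (v k)
  have i1 (j : ι) : Integrable (fun z => gibbsAverage β a fun k => ⟪v j, z⟫ * ⟪v k, z⟫) μ :=
    integrable_gibbsAverage β a (i0 j)
  have i2 : Integrable (fun z => gibbsAverage β a fun j => gibbsAverage β a fun k =>
    ⟪v j, z⟫ * ⟪v k, z⟫) μ := integrable_gibbsAverage β a i1
  have i3 : Integrable (fun z => gibbsAverage β a fun j => ⟪v j, z⟫ * ⟪v j, z⟫) μ :=
    integrable_gibbsAverage β a fun j => i0 j j
  simp_rw [smoothMaxHess, gibbsAverage_sq]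
  have i4 : Integrable (fun z => G₁ (smoothMax β a) * (β *
      ((gibbsAverage β a fun j => ⟪v j, z⟫ * ⟪v j, z⟫) -
        gibbsAverage β a fun j => gibbsAverage β a fun k => ⟪v j, z⟫ * ⟪v k, z⟫))) μ :=
    ((i3.sub i2).const_mul β).const_mul _
  refine ⟨(i2.const_mul _).add i4, ?_⟩
  rw [integral_add (i2.const_mul _) i4, integral_const_mul,
    integral_const_mul, integral_const_mul, integral_sub i3 i2,
    integral_gibbsAverage β a i1, integral_gibbsAverage β a fun j => i0 j j]
  simp_rw [integral_gibbsAverage β a (i0 _)]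

/-- The effect of adding one small increment, of law `μ` or `ν` and scaled by `h`, at a fixed base
point `a`. In the expansion the linear term integrates to zero and the quadratic term involves only
the covariances, which differ by at most `Δ`. -/
theorem abs_integral_comp_smoothMax_sub_le {μ ν : Measure E} [IsGaussian μ] [IsGaussian ν]
    (hμ : ∫ z, z ∂μ = 0) (hν : ∫ z, z ∂ν = 0) {v : ι → E} (hv : ∀ j, ‖v j‖ ≤ 1) {Δ : ℝ}
    (hΔ : ∀ j k, |∫ z, ⟪v j, z⟫ * ⟪v k, z⟫ ∂μ - ∫ z, ⟪v j, z⟫ * ⟪v k, z⟫ ∂ν| ≤ Δ)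
    {G G₁ G₂ G₃ : ℝ → ℝ} {B₁ B₂ B₃ β : ℝ}
    (hG : HasBoundedDerivs G G₁ G₂ G₃ B₁ B₂ B₃) (hG1 : ∀ x, |G x| ≤ 1) (hβ : 0 < β) (a : ι → ℝ)
    {h : ℝ} (hh : 0 ≤ h) :
    |∫ z, G (smoothMax β fun j => a j + h * ⟪v j, z⟫) ∂μ -
      ∫ z, G (smoothMax β fun j => a j + h * ⟪v j, z⟫) ∂ν| ≤
      h ^ 2 / 2 * ((B₂ + 2 * β * B₁) * Δ) +
        h ^ 3 * ((B₃ + 6 * β * B₂ + 6 * β ^ 2 * B₁) * (∫ z, ‖z‖ ^ 3 ∂μ + ∫ z, ‖z‖ ^ 3 ∂ν)) := by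
  set K := B₃ + 6 * β * B₂ + 6 * β ^ 2 * B₁
  set q : Measure E → ℝ := fun μ => ∫ z, smoothMaxHess G₁ G₂ β a (fun j => ⟪v j, z⟫) ∂μ with hq
  have hGc : Continuous G := continuous_iff_continuousAt.2 fun x => (hG.deriv₁ x).continuousAt
  have expand {μ : Measure E} [IsGaussian μ] (hμ : ∫ z, z ∂μ = 0) :
      |∫ z, G (smoothMax β fun j => a j + h * ⟪v j, z⟫) ∂μ - G (smoothMax β a) -
        h ^ 2 / 2 * q μ| ≤ h ^ 3 * (K * ∫ z, ‖z‖ ^ 3 ∂μ) := by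
    have iG : Integrable (fun z => G (smoothMax β fun j => a j + h * ⟪v j, z⟫)) μ := by
      refine Integrable.of_bound (C := 1) ?_ (ae_of_all _ fun z => hG1 _)
      refine (hGc.comp ((continuous_smoothMax β).comp ?_)).aestronglyMeasurable
      fun_prop
    have i1 : Integrable (fun z => gibbsAverage β a fun j => ⟪v j, z⟫) μ :=
      integrable_gibbsAverage β a fun j => integrable_inner_gaussian μ (v j)
    have i2 := (integral_smoothMaxHess μ v G₁ G₂ β a).1
    have e1 : ∫ z, gibbsAverage β a (fun j => ⟪v j, z⟫) ∂μ = 0 := by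
      rw [integral_gibbsAverage β a fun j => integrable_inner_gaussian μ (v j)]
      simp_rw [integral_inner_eq_zero_gaussian hμ]
      simp [gibbsAverage]
    have e2 : ∫ z, G (smoothMax β fun j => a j + h * ⟪v j, z⟫) ∂μ - G (smoothMax β a) -
        h ^ 2 / 2 * q μ = ∫ z, (G (smoothMax β fun j => a j + h * ⟪v j, z⟫) - G (smoothMax β a) -
          (G₁ (smoothMax β a) * h) * gibbsAverage β a (fun j => ⟪v j, z⟫) -
          h ^ 2 / 2 * smoothMaxHess G₁ G₂ β a (fun j => ⟪v j, z⟫)) ∂μ := by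
      have j1 : Integrable (fun z => G (smoothMax β fun j => a j + h * ⟪v j, z⟫) -
          G (smoothMax β a)) μ := iG.sub (integrable_const _)
      have j2 : Integrable (fun z => G (smoothMax β fun j => a j + h * ⟪v j, z⟫) -
          G (smoothMax β a) - (G₁ (smoothMax β a) * h) *
            gibbsAverage β a (fun j => ⟪v j, z⟫)) μ := j1.sub (i1.const_mul _)
      rw [integral_sub j2 (i2.const_mul _), integral_sub j1 (i1.const_mul _),
        integral_sub iG (integrable_const _), integral_const_mul, integral_const_mul, e1]
      simp [hq]
    rw [e2, ← integral_const_mul, ← integral_const_mul]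
    refine (abs_integral_le_integral_abs).trans ?_
    refine integral_mono_of_nonneg (ae_of_all _ fun z => abs_nonneg _)
      (((integrable_norm_pow_gaussian μ).const_mul _).const_mul _) (ae_of_all _ fun z => ?_)
    have hz (j : ι) : |h * ⟪v j, z⟫| ≤ h * ‖z‖ := by
      rw [abs_mul, abs_of_nonneg hh]
      gcongr
      refine (abs_real_inner_le_norm _ _).trans ?_
      exact mul_le_of_le_one_left (norm_nonneg _) (hv j)
    have := abs_comp_smoothMax_taylor_le hG hβ a hz
    have es : smoothMaxHess G₁ G₂ β a (fun j => h * ⟪v j, z⟫) =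
        h ^ 2 * smoothMaxHess G₁ G₂ β a (fun j => ⟪v j, z⟫) := by
      have : (fun j => h * ⟪v j, z⟫ * (h * ⟪v j, z⟫)) =
        fun j => h ^ 2 * (⟪v j, z⟫ * ⟪v j, z⟫) := by ext j; ring
      simp only [smoothMaxHess, this, gibbsAverage_const_mul]
      ring
    rw [es, gibbsAverage_const_mul] at this
    rw [← mul_assoc (G₁ (smoothMax β a)), ← div_mul_eq_mul_div] at this
    refine this.trans_eq ?_
    ring
  have hqd : |q μ - q ν| ≤ (B₂ + 2 * β * B₁) * Δ := by
    simp only [hq]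
    rw [(integral_smoothMaxHess μ v G₁ G₂ β a).2, (integral_smoothMaxHess ν v G₁ G₂ β a).2]
    have d1 := abs_gibbsAverage_le β a fun j => abs_gibbsAverage_le β a fun k => hΔ j k
    have d2 := abs_gibbsAverage_le β a fun j => hΔ j j
    simp_rw [gibbsAverage_sub] at d1 d2
    generalize (gibbsAverage β a fun j => gibbsAverage β a fun k =>
      ∫ z, ⟪v j, z⟫ * ⟪v k, z⟫ ∂μ) = x at *
    generalize (gibbsAverage β a fun j => gibbsAverage β a fun k =>
      ∫ z, ⟪v j, z⟫ * ⟪v k, z⟫ ∂ν) = x' at *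
    generalize (gibbsAverage β a fun j => ∫ z, ⟪v j, z⟫ * ⟪v j, z⟫ ∂μ) = y at *
    generalize (gibbsAverage β a fun j => ∫ z, ⟪v j, z⟫ * ⟪v j, z⟫ ∂ν) = y' at *
    have hB₁ := hG.bound₁ (smoothMax β a)
    have hB₂ := hG.bound₂ (smoothMax β a)
    have p₁ : 0 ≤ B₁ := (abs_nonneg _).trans hB₁
    have p₂ : 0 ≤ B₂ := (abs_nonneg _).trans hB₂
    generalize G₁ (smoothMax β a) = g₁ at *
    generalize G₂ (smoothMax β a) = g₂ at *
    calc _ = |g₂ * (x - x') + β * (g₁ * ((y - y') - (x - x')))| := by congr 1; ring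
      _ ≤ B₂ * Δ + β * (B₁ * (Δ + Δ)) := by
          refine (abs_add_le _ _).trans (add_le_add ?_ ?_)
          · rw [abs_mul]; gcongr
          · rw [abs_mul, abs_mul, abs_of_pos hβ]
            gcongr
            exact (abs_sub _ _).trans (add_le_add d2 d1)
      _ = _ := by ring
  have xμ := expand hμ
  have xν := expand hν
  have hqd' : |h ^ 2 / 2 * q μ - h ^ 2 / 2 * q ν| ≤ h ^ 2 / 2 * ((B₂ + 2 * β * B₁) * Δ) := by
    rw [← mul_sub, abs_mul, abs_of_nonneg (by positivity : 0 ≤ h ^ 2 / 2)]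
    gcongr
  rw [abs_le] at *
  constructor <;> nlinarith

/-- The law of `√s x + √t y`, for independent `x ∼ μ` and `y ∼ ν`. -/
noncomputable def gaussianInterpolation (μ ν : Measure E) (s t : ℝ) : Measure E :=
  mapAddProd μ ν (√s • ContinuousLinearMap.id ℝ E) (√t • ContinuousLinearMap.id ℝ E)

instance (μ ν : Measure E) [IsGaussian μ] [IsGaussian ν] (s t : ℝ) :
    IsGaussian (gaussianInterpolation μ ν s t) := by
  unfold gaussianInterpolation
  infer_instance

theorem integral_gaussianInterpolation_id {μ ν : Measure E} [IsGaussian μ] [IsGaussian ν]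
    (hμ : ∫ z, z ∂μ = 0) (hν : ∫ z, z ∂ν = 0) (s t : ℝ) :
    ∫ z, z ∂(gaussianInterpolation μ ν s t) = 0 :=
  integral_mapAddProd_id hμ hν _ _

theorem integral_inner_sq_gaussianInterpolation {μ ν : Measure E} [IsGaussian μ] [IsGaussian ν]
    (hμ : ∫ z, z ∂μ = 0) {s t : ℝ} (hs : 0 ≤ s) (ht : 0 ≤ t) (x : E) :
    ∫ z, ⟪x, z⟫ ^ 2 ∂(gaussianInterpolation μ ν s t) =
      s * ∫ z, ⟪x, z⟫ ^ 2 ∂μ + t * ∫ z, ⟪x, z⟫ ^ 2 ∂ν := by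
  rw [gaussianInterpolation, integral_inner_sq_mapAddProd hμ]
  simp [inner_smul_right, mul_pow, integral_const_mul, Real.sq_sqrt, hs, ht]

/-- Infinite divisibility: both sides are centered Gaussian with the same second moments. Together
with its mirror image it writes two neighbouring laws on the path as one common law plus a small
increment from `μ` or from `ν`. -/
theorem gaussianInterpolation_add_left {μ ν : Measure E} [IsGaussian μ] [IsGaussian ν]
    (hμ : ∫ z, z ∂μ = 0) (hν : ∫ z, z ∂ν = 0) {s t h : ℝ} (hs : 0 ≤ s) (ht : 0 ≤ t) (hh : 0 ≤ h) :
    gaussianInterpolation μ ν (s + h) t =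
      gaussianInterpolation (gaussianInterpolation μ ν s t) μ 1 h := by
  have h0 := integral_gaussianInterpolation_id hμ hν s t
  refine centeredGaussian_ext (integral_gaussianInterpolation_id hμ hν _ _)
    (integral_gaussianInterpolation_id h0 hμ _ _) fun x => ?_
  rw [integral_inner_sq_gaussianInterpolation hμ (by positivity) ht,
    integral_inner_sq_gaussianInterpolation h0 zero_le_one hh,
    integral_inner_sq_gaussianInterpolation hμ hs ht]
  ring

theorem gaussianInterpolation_add_right {μ ν : Measure E} [IsGaussian μ] [IsGaussian ν]
    (hμ : ∫ z, z ∂μ = 0) (hν : ∫ z, z ∂ν = 0) {s t h : ℝ} (hs : 0 ≤ s) (ht : 0 ≤ t) (hh : 0 ≤ h) :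
    gaussianInterpolation μ ν s (t + h) =
      gaussianInterpolation (gaussianInterpolation μ ν s t) ν 1 h := by
  have h0 := integral_gaussianInterpolation_id hμ hν s t
  refine centeredGaussian_ext (integral_gaussianInterpolation_id hμ hν _ _)
    (integral_gaussianInterpolation_id h0 hν _ _) fun x => ?_
  rw [integral_inner_sq_gaussianInterpolation hμ hs (by positivity),
    integral_inner_sq_gaussianInterpolation h0 zero_le_one hh,
    integral_inner_sq_gaussianInterpolation hμ hs ht]
  ring

theorem integral_gaussianInterpolation_one {κ μ : Measure E} [IsGaussian κ] [IsGaussian μ]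
    {m : E → ℝ} (hm : Continuous m) (hb : ∀ z, |m z| ≤ 1) (h : ℝ) :
    Integrable (fun w => ∫ z, m (w + √h • z) ∂μ) κ ∧
    ∫ z, m z ∂(gaussianInterpolation κ μ 1 h) = ∫ w, ∫ z, m (w + √h • z) ∂μ ∂κ := by
  have hi : Integrable (fun x : E × E => m (x.1 + √h • x.2)) (κ.prod μ) :=
    Integrable.of_bound (C := 1) (hm.comp (by fun_prop)).aestronglyMeasurable
      (ae_of_all _ fun z => hb _)
  refine ⟨hi.integral_prod_left, ?_⟩
  rw [gaussianInterpolation, mapAddProd, integral_map (by fun_prop) hm.aestronglyMeasurable]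
  simp only [Real.sqrt_one, one_smul, ContinuousLinearMap.id_apply,
    smul_apply]
  exact integral_prod _ hi

/-- **Gaussian comparison** for a smoothed maximum, with closeness of covariances. -/
theorem gaussian_comparison_smoothMax {μ ν : Measure E} [IsGaussian μ] [IsGaussian ν]
    (hμ : ∫ z, z ∂μ = 0) (hν : ∫ z, z ∂ν = 0) {v : ι → E} (hv : ∀ j, ‖v j‖ ≤ 1) {Δ : ℝ}
    (hΔ : ∀ j k, |∫ z, ⟪v j, z⟫ * ⟪v k, z⟫ ∂μ - ∫ z, ⟪v j, z⟫ * ⟪v k, z⟫ ∂ν| ≤ Δ)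
    {G G₁ G₂ G₃ : ℝ → ℝ} {B₁ B₂ B₃ β : ℝ}
    (hG : HasBoundedDerivs G G₁ G₂ G₃ B₁ B₂ B₃) (hG1 : ∀ x, |G x| ≤ 1) (hβ : 0 < β) (b : ι → ℝ) :
    |∫ z, G (smoothMax β fun j => ⟪v j, z⟫ - b j) ∂μ -
      ∫ z, G (smoothMax β fun j => ⟪v j, z⟫ - b j) ∂ν| ≤ (B₂ + 2 * β * B₁) * Δ / 2 := by
  set m : E → ℝ := fun z => G (smoothMax β fun j => ⟪v j, z⟫ - b j) with hm
  have hGc : Continuous G := continuous_iff_continuousAt.2 fun x => (hG.deriv₁ x).continuousAt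
  have hmc : Continuous m := hGc.comp ((continuous_smoothMax β).comp (by fun_prop))
  have hm1 (z : E) : |m z| ≤ 1 := hG1 _
  set Q := (B₂ + 2 * β * B₁) * Δ
  set R := (B₃ + 6 * β * B₂ + 6 * β ^ 2 * B₁) * (∫ z, ‖z‖ ^ 3 ∂μ + ∫ z, ‖z‖ ^ 3 ∂ν)
  have step (κ : Measure E) [IsGaussian κ] {h : ℝ} (hh : 0 ≤ h) :
      |∫ z, m z ∂(gaussianInterpolation κ μ 1 h) - ∫ z, m z ∂(gaussianInterpolation κ ν 1 h)| ≤
        √h ^ 2 / 2 * Q + √h ^ 3 * R := by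
    obtain ⟨i1, e1⟩ := integral_gaussianInterpolation_one (κ := κ) (μ := μ) hmc hm1 h
    obtain ⟨i2, e2⟩ := integral_gaussianInterpolation_one (κ := κ) (μ := ν) hmc hm1 h
    rw [e1, e2, ← integral_sub i1 i2]
    have : ∀ w, ‖∫ z, m (w + √h • z) ∂μ - ∫ z, m (w + √h • z) ∂ν‖ ≤
        √h ^ 2 / 2 * Q + √h ^ 3 * R := by
      intro w
      have := abs_integral_comp_smoothMax_sub_le hμ hν hv hΔ hG hG1 hβ (fun j => ⟪v j, w⟫ - b j)
        (Real.sqrt_nonneg h)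
      simp only [hm, inner_add_right, inner_smul_right]
      simpa only [Real.norm_eq_abs, sub_add_eq_add_sub] using this
    simpa using norm_integral_le_of_norm_le_const (μ := κ) (ae_of_all _ this)
  -- Of `M = N + 1` steps with increment variance `1/M`, each costs `Q/(2M) + M^{-3/2} R`. The
  -- third-order terms, including the third moments, sum to `R/√M` and disappear as `N → ∞`.
  have bound (N : ℕ) : |∫ z, m z ∂μ - ∫ z, m z ∂ν| ≤
      Q / 2 + (√((N : ℝ) + 1))⁻¹ * R := by
    set M : ℝ := (N : ℝ) + 1 with hM
    have hM0 : 0 < M := by positivity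
    let I : ℕ → ℝ := fun k => ∫ z, m z ∂(gaussianInterpolation μ ν (k / M) ((M - k) / M))
    have hI (k : ℕ) (hk : k < N + 1) : |I (k + 1) - I k| ≤ √M⁻¹ ^ 2 / 2 * Q + √M⁻¹ ^ 3 * R := by
      have hk' : (k : ℝ) + 1 ≤ M := by
        rw [hM]; exact_mod_cast Nat.succ_le_of_lt hk
      have hs : 0 ≤ (k : ℝ) / M := by positivity
      have ht : 0 ≤ (M - (k + 1)) / M := div_nonneg (by linarith) hM0.le
      have hh : 0 ≤ M⁻¹ := by positivity
      -- The common base law has total weight `1 - 1/M`: an increment from `μ` completes it to `I (k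
      -- + 1)`, one from `ν` to `I k`.
      have := step (gaussianInterpolation μ ν (k / M) ((M - (k + 1)) / M)) hh
      rw [← gaussianInterpolation_add_left hμ hν hs ht hh,
        ← gaussianInterpolation_add_right hμ hν hs ht hh] at this
      convert this using 8
      · push_cast; field_simp
      · push_cast; ring
      · field_simp; ring
    have hsum : |I (N + 1) - I 0| ≤ (N + 1 : ℕ) * (√M⁻¹ ^ 2 / 2 * Q + √M⁻¹ ^ 3 * R) := by
      rw [← Finset.sum_range_sub]
      refine (Finset.abs_sum_le_sum_abs _ _).trans ?_
      refine (Finset.sum_le_card_nsmul _ _ _ fun k hk => hI k (Finset.mem_range.1 hk)).trans_eq ?_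
      rw [Finset.card_range, nsmul_eq_mul]
    have hI1 : I (N + 1) = ∫ z, m z ∂μ := by
      have : gaussianInterpolation μ ν 1 0 = μ :=
        centeredGaussian_ext (integral_gaussianInterpolation_id hμ hν _ _) hμ fun x => by
          rw [integral_inner_sq_gaussianInterpolation hμ zero_le_one le_rfl]; ring
      have e : ((N + 1 : ℕ) : ℝ) = M := by simp [hM]
      simp only [I]
      rw [e, div_self hM0.ne', sub_self, zero_div, this]
    have hI0 : I 0 = ∫ z, m z ∂ν := by
      have : gaussianInterpolation μ ν 0 1 = ν :=
        centeredGaussian_ext (integral_gaussianInterpolation_id hμ hν _ _) hν fun x => by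
          rw [integral_inner_sq_gaussianInterpolation hμ le_rfl zero_le_one]; ring
      simp only [I, Nat.cast_zero]
      rw [sub_zero, div_self hM0.ne', zero_div, this]
    rw [hI1, hI0] at hsum
    refine hsum.trans_eq ?_
    have e : ((N + 1 : ℕ) : ℝ) = M := by simp [hM]
    rw [e, Real.sqrt_inv, show (√M)⁻¹ ^ 3 = (√M)⁻¹ ^ 2 * (√M)⁻¹ by ring, inv_pow,
      Real.sq_sqrt hM0.le]
    field_simp
  have hlim : Tendsto (fun N : ℕ => Q / 2 + (√((N : ℝ) + 1))⁻¹ * R) atTop (𝓝 (Q / 2 + 0 * R)) := by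
    refine tendsto_const_nhds.add (Tendsto.mul_const _ (tendsto_inv_atTop_zero.comp ?_))
    exact Real.tendsto_sqrt_atTop.comp
      (tendsto_natCast_atTop_atTop.atTop_add tendsto_const_nhds)
  rw [zero_mul, add_zero] at hlim
  exact ge_of_tendsto' hlim bound

end Comparison

/-! ### Smooth approximate indicators -/

theorem exists_bound_iteratedDeriv_smoothTransition (k : ℕ) (hk : k ≠ 0) :
    ∃ B, ∀ x, |iteratedDeriv k Real.smoothTransition x| ≤ B := by
  have hc : Continuous (iteratedDeriv k Real.smoothTransition) :=
    (Real.smoothTransition.contDiff (n := k)).continuous_iteratedDeriv' k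
  obtain ⟨B, hB⟩ := (isCompact_Icc (a := (0 : ℝ)) (b := 1)).exists_bound_of_continuousOn
    hc.continuousOn
  have h0 (c : ℝ) (x : ℝ) (h : Real.smoothTransition =ᶠ[𝓝 x] fun _ => c) :
      iteratedDeriv k Real.smoothTransition x = 0 := by
    rw [h.iteratedDeriv_eq, iteratedDeriv_const, if_neg hk]
  refine ⟨B, fun x => ?_⟩
  by_cases hx : x ∈ Set.Icc (0 : ℝ) 1
  · exact hB x hx
  · have hB0 : 0 ≤ B := (norm_nonneg _).trans (hB 0 (by simp))
    have : iteratedDeriv k Real.smoothTransition x = 0 := by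
      rcases lt_or_ge x 0 with h | h
      · exact h0 0 x ((gt_mem_nhds h).mono fun y hy => Real.smoothTransition.zero_of_nonpos hy.le)
      · have h1 : 1 < x := by
          by_contra! h'
          exact hx ⟨h, h'⟩
        exact h0 1 x ((lt_mem_nhds h1).mono fun y hy => Real.smoothTransition.one_of_one_le hy.le)
    rw [this, abs_zero]
    exact hB0

/-- One fixed step function is rescaled by `φ`, so each derivative gains a factor `φ` and the
constant `B` serves all widths. -/
theorem exists_smoothIndicator : ∃ B : ℝ, 0 < B ∧ ∀ φ : ℝ, 0 < φ → ∃ G G₁ G₂ G₃ : ℝ → ℝ,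
    HasBoundedDerivs G G₁ G₂ G₃ (φ * B) (φ ^ 2 * B) (φ ^ 3 * B) ∧
    (∀ x, 0 ≤ G x) ∧ (∀ x, G x ≤ 1) ∧ (∀ x ≤ 0, G x = 1) ∧ ∀ x, φ⁻¹ ≤ x → G x = 0 := by
  choose B hB using fun k : ℕ => exists_bound_iteratedDeriv_smoothTransition (k + 1) k.succ_ne_zero
  have hd (k : ℕ) (x : ℝ) : HasDerivAt (iteratedDeriv k Real.smoothTransition)
      (iteratedDeriv (k + 1) Real.smoothTransition x) x := by
    rw [iteratedDeriv_succ]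
    exact ((Real.smoothTransition.contDiff (n := (k + 1 : ℕ))).differentiable_iteratedDeriv k
      (by exact_mod_cast Nat.lt_succ_self k) x).hasDerivAt
  have hd' (φ : ℝ) (k : ℕ) (x : ℝ) :
      HasDerivAt (fun x => iteratedDeriv k Real.smoothTransition (φ * x))
        (iteratedDeriv (k + 1) Real.smoothTransition (φ * x) * φ) x := by
    have := (hd k (φ * x)).comp x ((hasDerivAt_id x).const_mul φ)
    exact this.congr_deriv (by simp)
  have hB0 (k : ℕ) : 0 ≤ B k := (abs_nonneg _).trans (hB k 0)
  refine ⟨B 0 + B 1 + B 2 + 1, by linarith [hB0 0, hB0 1, hB0 2], fun φ hφ => ?_⟩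
  refine ⟨fun x => 1 - Real.smoothTransition (φ * x),
    fun x => -(iteratedDeriv 1 Real.smoothTransition (φ * x) * φ),
    fun x => -(iteratedDeriv 2 Real.smoothTransition (φ * x) * φ * φ),
    fun x => -(iteratedDeriv 3 Real.smoothTransition (φ * x) * φ * φ * φ),
    ⟨fun x => ?_, fun x => ?_, fun x => ?_, fun x => ?_, fun x => ?_, fun x => ?_⟩,
    fun x => ?_, fun x => ?_, fun x hx => ?_, fun x hx => ?_⟩
  · have := hd' φ 0 x
    simp only [iteratedDeriv_zero] at this
    exact this.const_sub 1
  · exact ((hd' φ 1 x).mul_const φ).neg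
  · exact (((hd' φ 2 x).mul_const φ).mul_const φ).neg
  · rw [abs_neg, abs_mul, abs_of_pos hφ, mul_comm _ φ]
    gcongr
    linarith [hB 0 (φ * x), hB0 1, hB0 2]
  · rw [abs_neg, abs_mul, abs_mul, abs_of_pos hφ, mul_assoc, ← sq, mul_comm (φ ^ 2)]
    gcongr
    linarith [hB 1 (φ * x), hB0 0, hB0 2]
  · rw [abs_neg, abs_mul, abs_mul, abs_mul, abs_of_pos hφ, mul_assoc, mul_assoc,
      ← sq, ← pow_succ', mul_comm (φ ^ _)]
    gcongr
    linarith [hB 2 (φ * x), hB0 1, hB0 0]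
  · linarith [Real.smoothTransition.le_one (φ * x)]
  · linarith [Real.smoothTransition.nonneg (φ * x)]
  · change 1 - _ = (1 : ℝ)
    rw [Real.smoothTransition.zero_of_nonpos (mul_nonpos_of_nonneg_of_nonpos hφ.le hx), sub_zero]
  · change 1 - _ = (0 : ℝ)
    rw [Real.smoothTransition.one_of_one_le, sub_self]
    rwa [← div_le_iff₀' hφ, one_div]

/-- A constant bounding the derivatives of a smooth approximation of an indicator. -/
noncomputable def smoothIndicatorBound : ℝ := exists_smoothIndicator.choose

theorem smoothIndicatorBound_pos : 0 < smoothIndicatorBound :=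
  exists_smoothIndicator.choose_spec.1

/-! ### Gaussian comparison and anti-concentration on polyhedra -/

section Polyhedra

variable {E : Type*} [NormedAddCommGroup E] [InnerProductSpace ℝ E] [CompleteSpace E]
  [SecondCountableTopology E] [MeasurableSpace E] [BorelSpace E] {ι : Type*} [Fintype ι]

theorem measurableSet_polyhedron (v : ι → E) (b : ι → ℝ) :
    MeasurableSet {z | ∀ j, ⟪v j, z⟫ ≤ b j} := by
  rw [Set.ofPred_forall]
  exact .iInter fun j => measurableSet_le (by fun_prop) (by fun_prop)

/-- The smoothed indicator is squeezed between indicators of shifted polyhedra: a shift by `log N /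
β` pays for the smooth maximum, one by `1/φ` for the smooth step. Both shifts are charged to `ν`, so
anti-concentration is needed for one of the two measures only. -/
theorem gaussian_comparison_polyhedron [Nonempty ι] {μ ν : Measure E} [IsGaussian μ]
    [IsGaussian ν] (hμ : ∫ z, z ∂μ = 0) (hν : ∫ z, z ∂ν = 0) {v : ι → E} (hv : ∀ j, ‖v j‖ ≤ 1)
    {Δ : ℝ} (hΔ : ∀ j k, |∫ z, ⟪v j, z⟫ * ⟪v k, z⟫ ∂μ - ∫ z, ⟪v j, z⟫ * ⟪v k, z⟫ ∂ν| ≤ Δ)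
    {A : ℝ} (hA : ∀ (b : ι → ℝ) (ε : ℝ), 0 ≤ ε → ν.real {z | ∀ j, ⟪v j, z⟫ ≤ b j + ε} ≤
      ν.real {z | ∀ j, ⟪v j, z⟫ ≤ b j} + ε * A)
    {β φ : ℝ} (hβ : 0 < β) (hφ : 0 < φ) (b : ι → ℝ) :
    |μ.real {z | ∀ j, ⟪v j, z⟫ ≤ b j} - ν.real {z | ∀ j, ⟪v j, z⟫ ≤ b j}| ≤
      (Real.log (Fintype.card ι) / β + φ⁻¹) * A +
        smoothIndicatorBound * (φ ^ 2 + 2 * β * φ) * Δ / 2 := by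
  obtain ⟨G, G₁, G₂, G₃, hG, hG0, hG1, hGone, hGzero⟩ :=
    exists_smoothIndicator.choose_spec.2 φ hφ
  have habs (x : ℝ) : |G x| ≤ 1 := by rw [abs_of_nonneg (hG0 x)]; exact hG1 x
  have hcmp := gaussian_comparison_smoothMax hμ hν hv hΔ hG habs hβ
  set D := Real.log (Fintype.card ι) / β
  have hcard : (1 : ℝ) ≤ Fintype.card ι := by exact_mod_cast Fintype.card_pos
  have hD : 0 ≤ D := div_nonneg (Real.log_nonneg hcard) hβ.le
  have hφ' : 0 < φ⁻¹ := inv_pos.2 hφ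
  have hGc : Continuous G := continuous_iff_continuousAt.2 fun x => (hG.deriv₁ x).continuousAt
  have hint (κ : Measure E) [IsProbabilityMeasure κ] (b : ι → ℝ) :
      Integrable (fun z => G (smoothMax β fun j => ⟪v j, z⟫ - b j)) κ :=
    Integrable.of_bound (C := 1) (hGc.comp ((continuous_smoothMax β).comp
      (by fun_prop))).aestronglyMeasurable (ae_of_all _ fun z => habs _)
  have hlow (κ : Measure E) [IsProbabilityMeasure κ] (b : ι → ℝ) :
      κ.real {z | ∀ j, ⟪v j, z⟫ ≤ b j} ≤
        ∫ z, G (smoothMax β fun j => ⟪v j, z⟫ - (b j + D)) ∂κ := by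
    rw [← integral_indicator_one (measurableSet_polyhedron v b)]
    refine integral_mono ((integrable_const 1).indicator (measurableSet_polyhedron v b))
      (hint κ _) fun z => ?_
    by_cases hz : z ∈ {z | ∀ j, ⟪v j, z⟫ ≤ b j}
    · rw [Set.indicator_of_mem hz]
      refine (hGone _ ?_).ge
      have := smoothMax_le hβ (a := fun j => ⟪v j, z⟫ - (b j + D)) (c := -D)
        fun j => by linarith [hz j]
      linarith
    · rw [Set.indicator_of_notMem hz]
      exact hG0 _
  have hup (κ : Measure E) [IsProbabilityMeasure κ] (b : ι → ℝ) :
      ∫ z, G (smoothMax β fun j => ⟪v j, z⟫ - b j) ∂κ ≤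
        κ.real {z | ∀ j, ⟪v j, z⟫ ≤ b j + φ⁻¹} := by
    have hm := measurableSet_polyhedron v fun j => b j + φ⁻¹
    rw [← integral_indicator_one hm]
    refine integral_mono (hint κ _) ((integrable_const 1).indicator hm) fun z => ?_
    by_cases hz : z ∈ {z | ∀ j, ⟪v j, z⟫ ≤ b j + φ⁻¹}
    · rw [Set.indicator_of_mem hz]
      exact hG1 _
    · rw [Set.indicator_of_notMem hz]
      refine (hGzero _ ?_).le
      simp only [Set.mem_ofPred_eq, not_forall, not_le] at hz
      obtain ⟨j, hj⟩ := hz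
      have := le_smoothMax hβ (fun j => ⟪v j, z⟫ - b j) j
      linarith
  have key : smoothIndicatorBound * (φ ^ 2 + 2 * β * φ) * Δ / 2 =
      (φ ^ 2 * smoothIndicatorBound + 2 * β * (φ * smoothIndicatorBound)) * Δ / 2 := by ring
  rw [key, abs_sub_le_iff]
  set Q := (φ ^ 2 * smoothIndicatorBound + 2 * β * (φ * smoothIndicatorBound)) * Δ / 2
  constructor
  · have h1 := hlow μ b
    have h2 := (abs_le.1 (hcmp fun j => b j + D)).2
    have h3 := hup ν fun j => b j + D
    have h4 := hA b (D + φ⁻¹) (by positivity)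
    simp only [add_assoc] at h1 h2 h3 h4
    change _ ≤ Q at h2
    linarith
  · have h1 := hlow ν fun j => b j - (D + φ⁻¹)
    have h2 := (abs_le.1 (hcmp fun j => b j - φ⁻¹)).1
    have h3 := hup μ fun j => b j - φ⁻¹
    have h4 := hA (fun j => b j - (D + φ⁻¹)) (D + φ⁻¹) (by positivity)
    have e1 (j : ι) : b j - (D + φ⁻¹) + D = b j - φ⁻¹ := by ring
    simp only [sub_add_cancel, e1] at h1 h3 h4
    change -Q ≤ _ at h2
    linarith

theorem gaussian_antiConcentration_of_variance_ge [Nonempty ι] {ν : Measure E} [IsGaussian ν]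
    (hν : ∫ z, z ∂ν = 0) {v : ι → E} {k : ℝ} (hk : 0 < k)
    (hv : ∀ j, k ≤ ∫ z, ⟪v j, z⟫ ^ 2 ∂ν) (b : ι → ℝ) {ε : ℝ} (hε : 0 ≤ ε) :
    ν.real {z | ∀ j, ⟪v j, z⟫ ≤ b j + ε} ≤ ν.real {z | ∀ j, ⟪v j, z⟫ ≤ b j} +
      ε * ((√k)⁻¹ * (5 * √(2 * Real.log (Fintype.card ι)) + 6)) := by
  -- An arbitrary order, used only to break ties in the argmax.
  let _ : LinearOrder ι := LinearOrder.lift' (Fintype.equivFin ι) (Fintype.equivFin ι).injective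
  set σ : ι → ℝ := fun j => √(∫ z, ⟪v j, z⟫ ^ 2 ∂ν) with hσ
  have hσk (j : ι) : √k ≤ σ j := Real.sqrt_le_sqrt (hv j)
  have hk' : 0 < √k := Real.sqrt_pos.2 hk
  have hσ0 (j : ι) : 0 < σ j := hk'.trans_le (hσk j)
  have hcard : (1 : ℝ) ≤ Fintype.card ι := by exact_mod_cast Fintype.card_pos
  set τ := √(2 * Real.log (Fintype.card ι)) with hτ
  have hu (j : ι) : ∫ z, ⟪(σ j)⁻¹ • v j, z⟫ ^ 2 ∂ν = 1 := by
    simp_rw [real_inner_smul_left, mul_pow]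
    rw [integral_const_mul, inv_pow, hσ, Real.sq_sqrt (hk.le.trans (hv j)),
      inv_mul_cancel₀ (hk.trans_le (hv j)).ne']
  have h := gaussian_antiConcentration hν hu (fun j => (σ j)⁻¹ * b j) (ε := ε * (√k)⁻¹) (τ := τ)
    (by positivity) (Real.sqrt_nonneg _)
  have e1 : {z | ∀ j, ⟪(σ j)⁻¹ • v j, z⟫ ≤ (σ j)⁻¹ * b j} = {z | ∀ j, ⟪v j, z⟫ ≤ b j} := by
    ext z
    refine forall_congr' fun j => ?_
    rw [real_inner_smul_left, mul_le_mul_iff_right₀ (inv_pos.2 (hσ0 j))]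
  have e2 : {z | ∀ j, ⟪v j, z⟫ ≤ b j + ε} ⊆
      {z | ∀ j, ⟪(σ j)⁻¹ • v j, z⟫ ≤ (σ j)⁻¹ * b j + ε * (√k)⁻¹} := by
    intro z hz j
    rw [real_inner_smul_left]
    calc (σ j)⁻¹ * ⟪v j, z⟫ ≤ (σ j)⁻¹ * (b j + ε) :=
          mul_le_mul_of_nonneg_left (hz j) (inv_pos.2 (hσ0 j)).le
      _ = (σ j)⁻¹ * b j + ε * (σ j)⁻¹ := by ring
      _ ≤ _ := by
          gcongr
          exact hσk j
  -- This is the purpose of the choice of `τ`: the total factor becomes `5 (τ + 1) + 1 = 5 τ + 6`.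
  have e3 : Fintype.card ι * Real.exp (-τ ^ 2 / 2) = 1 := by
    rw [hτ, neg_div, Real.sq_sqrt (mul_nonneg zero_le_two (Real.log_nonneg hcard)),
      mul_div_cancel_left₀ _ two_ne_zero, Real.exp_neg, Real.exp_log (by linarith)]
    exact mul_inv_cancel₀ (by linarith)
  rw [e1, e3] at h
  refine (measureReal_mono e2).trans (h.trans_eq ?_)
  ring

end Polyhedra

/-! ### Exponential moments of log-concave marginals -/

section LogConcave

variable {p : ℕ} {μ : Measure (EuclideanSpace ℝ (Fin p))} [IsProbabilityMeasure μ]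

/-- **Borell's lemma** for half-spaces. -/
theorem IsLogConcave.measureReal_halfSpace_le (hμ : IsLogConcave μ)
    (u : EuclideanSpace ℝ (Fin p)) {s : ℝ} (hs : 0 < s)
    (h8 : μ.real {x | s ≤ |⟪u, x⟫|} ≤ 1 / 8) {t : ℝ} (ht : 1 < t) :
    μ.real {x | t * s ≤ ⟪u, x⟫} ≤ Real.exp (-t / 2) := by
  -- Chosen so that `l t s - (1 - l) s = s`: the combination of a point of the far half-space with a
  -- point of the slab still leaves the open slab, a region of mass at most 1/8.
  set l : ℝ := 2 / (t + 1) with hl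
  have hl0 : 0 < l := by positivity
  have hl1 : l < 1 := by rw [hl, div_lt_one (by linarith)]; linarith
  have hlt : l * (t + 1) = 2 := div_mul_cancel₀ _ (by linarith)
  set A := {x | t * s ≤ ⟪u, x⟫} with hA
  set B := {x | |⟪u, x⟫| ≤ s} with hB
  have hAc : IsClosed A := isClosed_le (by fun_prop) (by fun_prop)
  have hBc : IsClosed B := isClosed_le (by fun_prop) (by fun_prop)
  have hball (R : ℝ) : IsCompact (Metric.closedBall (0 : EuclideanSpace ℝ (Fin p)) R) :=
    isCompact_closedBall _ _
  have hR (R : ℕ) : μ.real (A ∩ Metric.closedBall 0 R) ^ l *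
      μ.real (B ∩ Metric.closedBall 0 R) ^ (1 - l) ≤ 1 / 8 := by
    have h := hμ _ _ ((hball R).inter_left hAc) ((hball R).inter_left hBc) l hl0 hl1
    have hsub : l • (A ∩ Metric.closedBall (0 : EuclideanSpace ℝ (Fin p)) R) +
        (1 - l) • (B ∩ Metric.closedBall (0 : EuclideanSpace ℝ (Fin p)) R) ⊆
          {x | s ≤ |⟪u, x⟫|} := by
      rintro _ ⟨_, ⟨x, hx, rfl⟩, _, ⟨y, hy, rfl⟩, rfl⟩
      have h1 : t * s ≤ ⟪u, x⟫ := hx.1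
      have h2 : -s ≤ ⟪u, y⟫ := (abs_le.1 hy.1).1
      change s ≤ |⟪u, l • x + (1 - l) • y⟫|
      refine le_trans ?_ (le_abs_self _)
      simp only [inner_add_right, inner_smul_right]
      nlinarith
    have h' := ENNReal.toReal_mono (measure_ne_top μ _) (h.trans (measure_mono hsub))
    rw [ENNReal.toReal_mul, ← ENNReal.toReal_rpow, ← ENNReal.toReal_rpow] at h'
    exact h'.trans h8
  -- Log-concavity concerns compact sets only, so the unbounded sets are exhausted by balls.
  have hlim (S : Set (EuclideanSpace ℝ (Fin p))) :
      Tendsto (fun R : ℕ => μ.real (S ∩ Metric.closedBall 0 R)) atTop (𝓝 (μ.real S)) := by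
    have hmono : Monotone fun R : ℕ => S ∩ Metric.closedBall (0 : EuclideanSpace ℝ (Fin p)) R :=
      fun i j hij => Set.inter_subset_inter_right _
        (Metric.closedBall_subset_closedBall (by exact_mod_cast hij))
    have h := tendsto_measure_iUnion_atTop (μ := μ) hmono
    rw [← Set.inter_iUnion, Metric.iUnion_closedBall_nat, Set.inter_univ] at h
    exact (ENNReal.tendsto_toReal (measure_ne_top μ S)).comp h
  have hAB : μ.real A ^ l * μ.real B ^ (1 - l) ≤ 1 / 8 :=
    le_of_tendsto' (((hlim A).rpow_const (Or.inr hl0.le)).mul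
      ((hlim B).rpow_const (Or.inr (by linarith)))) hR
  have hB78 : 7 / 8 ≤ μ.real B := by
    have h1 : μ.real Bᶜ ≤ 1 / 8 := by
      refine (measureReal_mono ?_).trans h8
      intro x hx
      exact (not_le.1 (show ¬ |⟪u, x⟫| ≤ s from hx)).le
    rw [probReal_compl_eq_one_sub hBc.measurableSet] at h1
    linarith
  have hB' : 7 / 8 ≤ μ.real B ^ (1 - l) := by
    calc (7 / 8 : ℝ) = (7 / 8 : ℝ) ^ (1 : ℝ) := (Real.rpow_one _).symm
      _ ≤ (7 / 8 : ℝ) ^ (1 - l) :=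
          Real.rpow_le_rpow_of_exponent_ge (by norm_num) (by norm_num) (by linarith)
      _ ≤ _ := by gcongr
  -- Dividing 1/8 by 7/8 leaves 1/7, and `e < 7`. Raising to the power `1/l = (t+1)/2` yields the
  -- exponential tail.
  have hAl : μ.real A ^ l ≤ Real.exp (-1) := by
    have h1 : μ.real A ^ l ≤ 1 / 7 := by
      have : 0 ≤ μ.real A ^ l := by positivity
      nlinarith
    have h2 : (1 / 7 : ℝ) ≤ Real.exp (-1) := by
      rw [Real.exp_neg, one_div]
      gcongr
      linarith [Real.exp_one_lt_d9]
    exact h1.trans h2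
  have h3 : μ.real A ≤ Real.exp (-1) ^ (l⁻¹) := by
    have := Real.rpow_le_rpow (by positivity) hAl (inv_pos.2 hl0).le
    rwa [← Real.rpow_mul (by positivity), mul_inv_cancel₀ hl0.ne', Real.rpow_one] at this
  refine h3.trans ?_
  rw [← Real.exp_mul, hl, inv_div]
  gcongr
  linarith

/-- The exponential moment constant of log-concave marginals. -/
noncomputable def logConcaveExpBound : ℝ :=
  ∑' k : ℕ, Real.exp ((k + 1) / 4) * (2 * Real.exp (-k / 2))

theorem summable_logConcaveExpBound :
    Summable fun k : ℕ => Real.exp (((k : ℝ) + 1) / 4) * (2 * Real.exp (-(k : ℝ) / 2)) := by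
  have e (k : ℕ) : Real.exp (((k : ℝ) + 1) / 4) * (2 * Real.exp (-(k : ℝ) / 2)) =
      2 * Real.exp (1 / 4) * Real.exp (-(1 / 4)) ^ k := by
    rw [← Real.exp_nat_mul, mul_left_comm, ← Real.exp_add, mul_assoc, ← Real.exp_add]
    congr 2
    ring
  simp_rw [e]
  refine (summable_geometric_of_lt_one (Real.exp_pos _).le ?_).mul_left _
  rw [Real.exp_lt_one_iff]
  norm_num

/-- The space is cut into layers according to the integer part `k` of `|⟪u, x⟫| / s`. The integrand
grows like `exp (k/4)` while the tail decays like `exp (-k/2)`, so the series converges to a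
constant that depends neither on the measure nor on the dimension. -/
theorem IsLogConcave.exp_moment (hμ : IsLogConcave μ)
    (u : EuclideanSpace ℝ (Fin p)) {s : ℝ} (hs : 0 < s)
    (h8 : μ.real {x | s ≤ |⟪u, x⟫|} ≤ 1 / 8) :
    Integrable (fun x => Real.exp ((4 * s)⁻¹ * |⟪u, x⟫|)) μ ∧
      ∫ x, Real.exp ((4 * s)⁻¹ * |⟪u, x⟫|) ∂μ ≤ logConcaveExpBound := by
  have htail (k : ℕ) : μ {x | k * s ≤ |⟪u, x⟫|} ≤ ENNReal.ofReal (2 * Real.exp (-k / 2)) := by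
    rw [ENNReal.le_ofReal_iff_toReal_le (measure_ne_top _ _) (by positivity)]
    change μ.real _ ≤ _
    rcases le_or_gt k 1 with hk | hk
    · refine (measureReal_le_one).trans ?_
      have h1 : -(1 / 2 : ℝ) ≤ -k / 2 := by
        have : (k : ℝ) ≤ 1 := by exact_mod_cast hk
        linarith
      have := Real.exp_le_exp.2 h1
      have := Real.add_one_le_exp (-(1 / 2 : ℝ))
      linarith
    · have hk' : (1 : ℝ) < k := by exact_mod_cast hk
      have h8' : μ.real {x | s ≤ |⟪-u, x⟫|} ≤ 1 / 8 := by simpa only [inner_neg_left, abs_neg]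
      have h1 := hμ.measureReal_halfSpace_le u hs h8 hk'
      have h2 := hμ.measureReal_halfSpace_le (-u) hs h8' hk'
      have hsub : {x | k * s ≤ |⟪u, x⟫|} ⊆ {x | k * s ≤ ⟪u, x⟫} ∪ {x | k * s ≤ ⟪-u, x⟫} := by
        intro x hx
        rcases le_abs.1 (show k * s ≤ |⟪u, x⟫| from hx) with h | h
        · exact Or.inl h
        · exact Or.inr (by simpa [inner_neg_left] using h)
      have h3 := (measureReal_mono hsub (μ := μ)).trans (measureReal_union_le _ _)
      linarith
  have hbound : ∫⁻ x, ENNReal.ofReal (Real.exp ((4 * s)⁻¹ * |⟪u, x⟫|)) ∂μ ≤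
      ENNReal.ofReal logConcaveExpBound := by
    have hm (k : ℕ) : MeasurableSet {x : EuclideanSpace ℝ (Fin p) | k * s ≤ |⟪u, x⟫|} :=
      (isClosed_le (by fun_prop) (by fun_prop)).measurableSet
    calc _ ≤ ∫⁻ x, ∑' k : ℕ, {x : EuclideanSpace ℝ (Fin p) | k * s ≤ |⟪u, x⟫|}.indicator
            (fun _ => ENNReal.ofReal (Real.exp ((k + 1) / 4))) x ∂μ := by
          refine lintegral_mono fun x => ?_
          set w := |⟪u, x⟫| / s with hw
          have hw0 : 0 ≤ w := by positivity
          refine le_trans ?_ (ENNReal.le_tsum ⌊w⌋₊)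
          rw [Set.indicator_of_mem]
          · refine ENNReal.ofReal_le_ofReal (Real.exp_le_exp.2 ?_)
            have h1 : (4 * s)⁻¹ * |⟪u, x⟫| = w / 4 := by rw [hw]; field_simp
            rw [h1]
            linarith [Nat.lt_floor_add_one w]
          · change (⌊w⌋₊ : ℝ) * s ≤ _
            rw [← le_div_iff₀ hs]
            exact Nat.floor_le hw0
      _ = ∑' k : ℕ, ENNReal.ofReal (Real.exp ((k + 1) / 4)) * μ {x | k * s ≤ |⟪u, x⟫|} := by
          rw [lintegral_tsum fun k => (measurable_const.indicator (hm k)).aemeasurable]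
          simp_rw [lintegral_indicator (hm _), setLIntegral_const]
      _ ≤ ∑' k : ℕ, ENNReal.ofReal (Real.exp ((k + 1) / 4) * (2 * Real.exp (-k / 2))) := by
          refine ENNReal.tsum_le_tsum fun k => ?_
          rw [ENNReal.ofReal_mul (Real.exp_pos _).le]
          gcongr
          exact htail k
      _ = _ := by
          rw [logConcaveExpBound, ENNReal.ofReal_tsum_of_nonneg (fun k => by positivity)
            summable_logConcaveExpBound]
  have hmeas : AEStronglyMeasurable (fun x => Real.exp ((4 * s)⁻¹ * |⟪u, x⟫|)) μ :=
    Continuous.aestronglyMeasurable (by fun_prop)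
  have hnn : 0 ≤ᵐ[μ] fun x => Real.exp ((4 * s)⁻¹ * |⟪u, x⟫|) :=
    ae_of_all _ fun x => (Real.exp_pos _).le
  refine ⟨⟨hmeas, ?_⟩, ?_⟩
  · rw [hasFiniteIntegral_iff_ofReal hnn]
    exact hbound.trans_lt ENNReal.ofReal_lt_top
  · rw [integral_eq_lintegral_of_nonneg_ae hnn hmeas]
    exact ENNReal.toReal_le_of_le_ofReal (tsum_nonneg fun k => by positivity) hbound

end LogConcave

/-! ### Concentration of empirical second moments -/

section Concentration

variable {Ω : Type*} [MeasurableSpace Ω] {P : Measure Ω} [IsProbabilityMeasure P]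

/-- By the arithmetic-geometric mean inequality `√|xy| ≤ (|x| + |y|)/2`, so exponential moments of
two factors control `exp (c √|xy|)`. Half of that rate is spent on the factor `(xy)²`, through the
fourth term of the exponential series. -/
theorem sq_mul_exp_sqrt_abs_mul_le {c : ℝ} (hc : 0 < c) (x y : ℝ) :
    (x * y) ^ 2 * Real.exp (c / 2 * √|x * y|) ≤
      384 / c ^ 4 * ((Real.exp (c * |x|) + Real.exp (c * |y|)) / 2) := by
  set s := √|x * y| with hs
  have hs0 : 0 ≤ s := Real.sqrt_nonneg _
  have hs2 : s ^ 2 = |x * y| := Real.sq_sqrt (abs_nonneg _)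
  have h1 : (x * y) ^ 2 = s ^ 4 := by
    rw [show s ^ 4 = (s ^ 2) ^ 2 by ring, hs2, sq_abs]
  have h2 : s ^ 4 ≤ 384 / c ^ 4 * Real.exp (c / 2 * s) := by
    have := Real.pow_div_factorial_le_exp (c / 2 * s) (by positivity) 4
    have e : (c / 2 * s) ^ 4 / (Nat.factorial 4 : ℝ) = c ^ 4 / 384 * s ^ 4 := by
      norm_num [Nat.factorial]
      ring
    rw [e] at this
    calc s ^ 4 = 384 / c ^ 4 * (c ^ 4 / 384 * s ^ 4) := by field_simp
      _ ≤ _ := by gcongr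
  have h3 : s ≤ (|x| + |y|) / 2 := by
    refine Real.sqrt_le_iff.2 ⟨by positivity, ?_⟩
    rw [abs_mul]
    nlinarith [sq_nonneg (|x| - |y|)]
  have h4 : Real.exp (c / 2 * s) ^ 2 ≤ (Real.exp (c * |x|) + Real.exp (c * |y|)) / 2 := by
    have e1 : Real.exp (c * |x|) = Real.exp (c / 2 * |x|) ^ 2 := by
      rw [← Real.exp_nat_mul]; congr 1; push_cast; ring
    have e2 : Real.exp (c * |y|) = Real.exp (c / 2 * |y|) ^ 2 := by
      rw [← Real.exp_nat_mul]; congr 1; push_cast; ring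
    have e3 : Real.exp (c / 2 * s) ^ 2 ≤ Real.exp (c / 2 * |x|) * Real.exp (c / 2 * |y|) := by
      rw [← Real.exp_nat_mul, ← Real.exp_add]
      gcongr
      push_cast
      nlinarith
    nlinarith [sq_nonneg (Real.exp (c / 2 * |x|) - Real.exp (c / 2 * |y|))]
  rw [h1]
  calc s ^ 4 * Real.exp (c / 2 * s) ≤
        384 / c ^ 4 * Real.exp (c / 2 * s) * Real.exp (c / 2 * s) := by gcongr
    _ = 384 / c ^ 4 * Real.exp (c / 2 * s) ^ 2 := by ring
    _ ≤ _ := by gcongr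

/-- `f` has an exponential moment at rate `c`, bounded by `M`. -/
structure HasExpMoment (P : Measure Ω) (f : Ω → ℝ) (c M : ℝ) : Prop where
  measurable : Measurable f
  integrable : Integrable (fun ω => Real.exp (c * |f ω|)) P
  integral_le : ∫ ω, Real.exp (c * |f ω|) ∂P ≤ M

/-- `f ^ 2` has a stretched exponential moment at rate `c`, bounded by `M`. -/
structure HasSqrtExpMoment (P : Measure Ω) (f : Ω → ℝ) (c M : ℝ) : Prop where
  measurable : Measurable f
  integrable : Integrable (fun ω => f ω ^ 2 * Real.exp (c * √|f ω|)) P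
  integral_le : ∫ ω, f ω ^ 2 * Real.exp (c * √|f ω|) ∂P ≤ M

theorem HasExpMoment.mul {f g : Ω → ℝ} {c M : ℝ} (hc : 0 < c) (hf : HasExpMoment P f c M)
    (hg : HasExpMoment P g c M) :
    HasSqrtExpMoment P (fun ω => f ω * g ω) (c / 2) (384 / c ^ 4 * M) := by
  have hm := hf.measurable
  have hm' := hg.measurable
  have hi : Integrable (fun ω => 384 / c ^ 4 *
      ((Real.exp (c * |f ω|) + Real.exp (c * |g ω|)) / 2)) P :=
    ((hf.integrable.add hg.integrable).div_const 2).const_mul _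
  have hi' : Integrable (fun ω => (f ω * g ω) ^ 2 * Real.exp (c / 2 * √|f ω * g ω|)) P := by
    refine hi.mono' (Measurable.aestronglyMeasurable (by fun_prop)) (ae_of_all _ fun ω => ?_)
    rw [Real.norm_of_nonneg (by positivity)]
    exact sq_mul_exp_sqrt_abs_mul_le hc _ _
  refine ⟨by fun_prop, hi', ?_⟩
  refine (integral_mono hi' hi fun ω => sq_mul_exp_sqrt_abs_mul_le hc _ _).trans ?_
  rw [integral_const_mul, integral_div, integral_add hf.integrable hg.integrable]
  gcongr
  linarith [hf.integral_le, hg.integral_le]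

theorem HasExpMoment.measureReal_lt_abs_le {f : Ω → ℝ} {c M : ℝ} (hc : 0 < c)
    (hf : HasExpMoment P f c M) (r : ℝ) :
    P.real {ω | r < |f ω|} ≤ M * Real.exp (-c * r) := by
  have h := mul_meas_ge_le_integral_of_nonneg (μ := P) (f := fun ω => Real.exp (c * |f ω|))
    (ae_of_all _ fun ω => (Real.exp_pos _).le) hf.integrable (Real.exp (c * r))
  have hsub : {ω | r < |f ω|} ⊆ {ω | Real.exp (c * r) ≤ Real.exp (c * |f ω|)} := by
    intro ω hω
    exact Real.exp_le_exp.2 (mul_le_mul_of_nonneg_left (le_of_lt hω) hc.le)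
  have h1 := measureReal_mono hsub (μ := P)
  have h2 : Real.exp (c * r) * P.real {ω | r < |f ω|} ≤ M :=
    (mul_le_mul_of_nonneg_left h1 (Real.exp_pos _).le).trans (h.trans hf.integral_le)
  rw [neg_mul, Real.exp_neg, ← div_eq_mul_inv, le_div_iff₀ (Real.exp_pos _), mul_comm]
  exact h2

theorem HasSqrtExpMoment.neg {f : Ω → ℝ} {c M : ℝ} (hf : HasSqrtExpMoment P f c M) :
    HasSqrtExpMoment P (fun ω => -f ω) c M := by
  refine ⟨hf.measurable.neg, ?_, ?_⟩
  · simpa using hf.integrable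
  · simpa using hf.integral_le

theorem exp_le_one_add_add_sq_mul_exp (x : ℝ) :
    Real.exp x ≤ 1 + x + x ^ 2 * Real.exp |x| := by
  have h := Complex.norm_exp_sub_sum_le_norm_mul_exp (x : ℂ) 2
  simp only [Finset.sum_range_succ, Finset.sum_range_zero, pow_zero, Nat.factorial, pow_one,
    Nat.cast_one, div_one, zero_add, mul_one] at h
  have e : Complex.exp x - (1 + (x : ℂ)) = ((Real.exp x - (1 + x) : ℝ) : ℂ) := by push_cast; ring
  rw [e, Complex.norm_real, Complex.norm_real, Real.norm_eq_abs, Real.norm_eq_abs, sq_abs] at h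
  linarith [le_abs_self (Real.exp x - (1 + x))]

/-- The truncation of a real number at level `B`. -/
noncomputable def truncateAt (B x : ℝ) : ℝ := if |x| ≤ B then x else 0

theorem measurable_truncateAt (B : ℝ) : Measurable (truncateAt B) :=
  Measurable.ite (measurableSet_le (by fun_prop) (by fun_prop)) measurable_id measurable_const

theorem abs_truncateAt_le_abs (B x : ℝ) : |truncateAt B x| ≤ |x| := by
  rw [truncateAt]; split_ifs <;> simp

theorem abs_truncateAt_le {B : ℝ} (hB : 0 ≤ B) (x : ℝ) : |truncateAt B x| ≤ B := by
  rw [truncateAt]; split_ifs with h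
  · exact h
  · simpa using hB

theorem HasSqrtExpMoment.integrable_of {f : Ω → ℝ} {c M : ℝ} (hc : 0 ≤ c)
    (hf : HasSqrtExpMoment P f c M) : Integrable f P := by
  refine ((integrable_const (1 : ℝ)).add hf.integrable).mono'
    hf.measurable.aestronglyMeasurable (ae_of_all _ fun ω => ?_)
  rw [Real.norm_eq_abs, Pi.add_apply]
  have h1 : 1 ≤ Real.exp (c * √|f ω|) := Real.one_le_exp (by positivity)
  have h2 : |f ω| ≤ 1 + f ω ^ 2 := by nlinarith [sq_abs (f ω), sq_nonneg (|f ω| - 1)]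
  nlinarith [sq_nonneg (f ω)]

/-- Without truncation the moment generating function may be infinite. At level `(c/l)²` one has `l
|T| ≤ c √|T|`, so the quadratic remainder of the exponential is bounded by the stretched moment.
Centering is at the mean of `f` itself, and the truncation bias is also of order `l²`. -/
theorem HasSqrtExpMoment.mgf_truncateAt_le {f : Ω → ℝ} {c M l : ℝ} (hc : 0 < c)
    (hf : HasSqrtExpMoment P f c M) (hl : 0 < l) (hl1 : l ≤ 1) :
    mgf (fun ω => truncateAt ((c / l) ^ 2) (f ω) - ∫ ω, f ω ∂P) P l ≤
      Real.exp (l ^ 2 * (M * (1 + (c ^ 2)⁻¹))) := by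
  set B := (c / l) ^ 2 with hB
  have hB0 : 0 < B := by positivity
  set T : Ω → ℝ := fun ω => truncateAt B (f ω) with hT
  have hTm : Measurable T := (measurable_truncateAt B).comp hf.measurable
  have hTi : Integrable T P := Integrable.of_bound (C := B) hTm.aestronglyMeasurable
    (ae_of_all _ fun ω => abs_truncateAt_le hB0.le _)
  have hfi := hf.integrable_of hc.le
  have hTexp (ω : Ω) : (l * T ω) ^ 2 * Real.exp |l * T ω| ≤
      l ^ 2 * (f ω ^ 2 * Real.exp (c * √|f ω|)) := by
    have h1 : |T ω| ≤ |f ω| := abs_truncateAt_le_abs _ _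
    have h2 : |l * T ω| ≤ c * √|f ω| := by
      have h3 : √|T ω| ≤ c / l := by
        refine Real.sqrt_le_iff.2 ⟨by positivity, abs_truncateAt_le hB0.le _⟩
      calc |l * T ω| = l * (√|T ω| * √|T ω|) := by
            rw [Real.mul_self_sqrt (abs_nonneg _), abs_mul, abs_of_pos hl]
        _ ≤ l * (c / l * √|f ω|) := by gcongr
        _ = _ := by field_simp
    rw [mul_pow, mul_assoc]
    have h4 : T ω ^ 2 ≤ f ω ^ 2 := sq_le_sq.2 h1
    gcongr
  have hexp : ∫ ω, Real.exp (l * T ω) ∂P ≤ 1 + l * ∫ ω, T ω ∂P + l ^ 2 * M := by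
    have hi : Integrable (fun ω => 1 + l * T ω + l ^ 2 * (f ω ^ 2 * Real.exp (c * √|f ω|))) P :=
      ((integrable_const _).add (hTi.const_mul l)).add (hf.integrable.const_mul _)
    have h1 : ∫ ω, Real.exp (l * T ω) ∂P ≤
        ∫ ω, (1 + l * T ω + l ^ 2 * (f ω ^ 2 * Real.exp (c * √|f ω|))) ∂P := by
      refine integral_mono_of_nonneg (ae_of_all _ fun ω => (Real.exp_pos _).le) hi
        (ae_of_all _ fun ω => ?_)
      exact (exp_le_one_add_add_sq_mul_exp _).trans (by simpa using hTexp ω)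
    refine h1.trans ?_
    have hi' : Integrable (fun ω => 1 + l * T ω) P := (integrable_const _).add (hTi.const_mul l)
    rw [integral_add hi' (hf.integrable.const_mul _), integral_add (integrable_const _)
      (hTi.const_mul l), integral_const_mul, integral_const_mul]
    simp only [integral_const, probReal_univ, smul_eq_mul, mul_one]
    gcongr
    exact hf.integral_le
  have hM : 0 ≤ M := (integral_nonneg fun ω => by positivity).trans hf.integral_le
  have hdiff : ∫ ω, T ω ∂P - ∫ ω, f ω ∂P ≤ l ^ 2 / c ^ 2 * M := by
    rw [← integral_sub hTi hfi]
    have h1 : ∫ ω, (T ω - f ω) ∂P ≤ ∫ ω, l ^ 2 / c ^ 2 * (f ω ^ 2 * Real.exp (c * √|f ω|)) ∂P := by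
      refine integral_mono (hTi.sub hfi) (hf.integrable.const_mul _) fun ω => ?_
      have h0 : 0 ≤ l ^ 2 / c ^ 2 * (f ω ^ 2 * Real.exp (c * √|f ω|)) := by positivity
      simp only [hT, truncateAt]
      split_ifs with h
      · simpa using h0
      · have h3 : B < |f ω| := not_le.1 h
        -- Beyond the truncation level `B` one has `|f| ≤ f² / B`, and `1/B = l²/c²`.
        have h4 : 1 ≤ l ^ 2 / c ^ 2 * |f ω| := by
          calc (1 : ℝ) = l ^ 2 / c ^ 2 * B := by rw [hB]; field_simp
            _ ≤ _ := by gcongr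
        have h5 : 1 ≤ Real.exp (c * √|f ω|) := Real.one_le_exp (by positivity)
        calc 0 - f ω ≤ |f ω| := by linarith [neg_abs_le (f ω)]
          _ ≤ l ^ 2 / c ^ 2 * |f ω| * |f ω| := le_mul_of_one_le_left (abs_nonneg _) h4
          _ = l ^ 2 / c ^ 2 * (f ω ^ 2 * 1) := by rw [mul_assoc, abs_mul_abs_self]; ring
          _ ≤ _ := by gcongr
    refine h1.trans ?_
    rw [integral_const_mul]
    gcongr
    exact hf.integral_le
  set m := ∫ ω, f ω ∂P
  have hmgf : mgf (fun ω => T ω - m) P l =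
      Real.exp (-(l * m)) * ∫ ω, Real.exp (l * T ω) ∂P := by
    rw [mgf, ← integral_const_mul]
    congr 1 with ω
    rw [← Real.exp_add]
    ring_nf
  rw [hmgf]
  calc _ ≤ Real.exp (-(l * m)) * Real.exp (l * ∫ ω, T ω ∂P + l ^ 2 * M) := by
        gcongr
        linarith [Real.add_one_le_exp (l * ∫ ω, T ω ∂P + l ^ 2 * M)]
    _ = Real.exp (l * (∫ ω, T ω ∂P - m) + l ^ 2 * M) := by
        rw [← Real.exp_add]
        congr 1
        ring
    _ ≤ _ := by
        gcongr
        have : l * (∫ ω, T ω ∂P - m) ≤ 1 * (l ^ 2 / c ^ 2 * M) := by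
          calc _ ≤ l * (l ^ 2 / c ^ 2 * M) := by gcongr
            _ ≤ _ := by gcongr
        calc _ ≤ 1 * (l ^ 2 / c ^ 2 * M) + l ^ 2 * M := by gcongr
          _ = _ := by ring

/-- Bernstein-type inequality on the event that none of the summands is large. -/
theorem measureReal_sum_sub_ge_le {n : ℕ} {f : Fin n → Ω → ℝ} {c M l : ℝ} (hc : 0 < c)
    (hf : ∀ i, HasSqrtExpMoment P (f i) c M) (hind : iIndepFun f P) (hl : 0 < l) (hl1 : l ≤ 1)
    (t : ℝ) :
    P.real {ω | (∀ i, |f i ω| ≤ (c / l) ^ 2) ∧ n * t ≤ ∑ i, (f i ω - ∫ ω, f i ω ∂P)} ≤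
      Real.exp (-l * (n * t) + n * (l ^ 2 * (M * (1 + (c ^ 2)⁻¹)))) := by
  set B := (c / l) ^ 2 with hB
  have hB0 : 0 < B := by positivity
  set g : Fin n → Ω → ℝ := fun i ω => truncateAt B (f i ω) - ∫ ω, f i ω ∂P with hg
  have hgm (i : Fin n) : Measurable (g i) :=
    ((measurable_truncateAt B).comp (hf i).measurable).sub_const _
  have hgind : iIndepFun g P :=
    hind.comp (fun i x => truncateAt B x - ∫ ω, f i ω ∂P)
      fun i => (measurable_truncateAt B).sub_const _
  have hsub : {ω | (∀ i, |f i ω| ≤ B) ∧ n * t ≤ ∑ i, (f i ω - ∫ ω, f i ω ∂P)} ⊆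
      {ω | n * t ≤ (∑ i, g i) ω} := by
    rintro ω ⟨h1, h2⟩
    simp only [Set.mem_ofPred_eq, Finset.sum_apply, hg]
    simpa [truncateAt, h1] using h2
  have hint : Integrable (fun ω => Real.exp (l * (∑ i, g i) ω)) P := by
    have hmeas : Measurable (∑ i, g i) := by
      rw [Finset.sum_fn]
      exact Finset.measurable_sum _ fun i _ => hgm i
    refine Integrable.of_bound (C := Real.exp (l * ∑ i, (B + |∫ ω, f i ω ∂P|)))
      (Measurable.aestronglyMeasurable (by fun_prop)) (ae_of_all _ fun ω => ?_)
    rw [Real.norm_eq_abs, Real.abs_exp, Finset.sum_apply]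
    gcongr with i
    have h1 := (abs_le.1 (abs_truncateAt_le hB0.le (f i ω))).2
    have h2 := neg_abs_le (∫ ω, f i ω ∂P)
    simp only [hg]
    linarith
  refine (measureReal_mono hsub).trans ((measure_ge_le_exp_mul_mgf _ hl.le hint).trans ?_)
  rw [hgind.mgf_sum hgm, Real.exp_add]
  gcongr
  calc ∏ i, mgf (g i) P l ≤ ∏ _i : Fin n, Real.exp (l ^ 2 * (M * (1 + (c ^ 2)⁻¹))) :=
        Finset.prod_le_prod (fun i _ => mgf_nonneg) fun i _ => (hf i).mgf_truncateAt_le hc hl hl1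
    _ = _ := by simp [← Real.exp_nat_mul]

theorem measureReal_abs_sum_sub_ge_le {n : ℕ} {f : Fin n → Ω → ℝ} {c M l : ℝ} (hc : 0 < c)
    (hf : ∀ i, HasSqrtExpMoment P (f i) c M) (hind : iIndepFun f P) (hl : 0 < l) (hl1 : l ≤ 1)
    (t : ℝ) :
    P.real {ω | (∀ i, |f i ω| ≤ (c / l) ^ 2) ∧ n * t ≤ |∑ i, (f i ω - ∫ ω, f i ω ∂P)|} ≤
      2 * Real.exp (-l * (n * t) + n * (l ^ 2 * (M * (1 + (c ^ 2)⁻¹)))) := by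
  have h1 := measureReal_sum_sub_ge_le hc hf hind hl hl1 t
  have h2 := measureReal_sum_sub_ge_le hc (fun i => (hf i).neg)
    (hind.comp (fun _ x => -x) fun _ => measurable_neg) hl hl1 t
  have hsub : {ω | (∀ i, |f i ω| ≤ (c / l) ^ 2) ∧ n * t ≤ |∑ i, (f i ω - ∫ ω, f i ω ∂P)|} ⊆
      {ω | (∀ i, |f i ω| ≤ (c / l) ^ 2) ∧ n * t ≤ ∑ i, (f i ω - ∫ ω, f i ω ∂P)} ∪
      {ω | (∀ i, |-f i ω| ≤ (c / l) ^ 2) ∧ n * t ≤ ∑ i, (-f i ω - ∫ ω, -f i ω ∂P)} := by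
    rintro ω ⟨h, h'⟩
    rcases le_abs.1 h' with h' | h'
    · exact Or.inl ⟨h, h'⟩
    · refine Or.inr ⟨by simpa using h, h'.trans_eq ?_⟩
      rw [← Finset.sum_neg_distrib]
      refine Finset.sum_congr rfl fun i _ => ?_
      rw [integral_neg]
      ring
  refine (measureReal_mono hsub).trans ((measureReal_union_le _ _).trans ?_)
  linarith

variable {E : Type*} [NormedAddCommGroup E] [InnerProductSpace ℝ E] [SecondCountableTopology E]
  [MeasurableSpace E] [BorelSpace E]

/-- The event that the empirical second moments and means along directions in `V` are within `t`
of their expectations. -/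
def empiricalMomentEvent {n : ℕ} (P : Measure Ω) (X : Fin n → Ω → E) (V : Finset E) (t : ℝ) :
    Set Ω :=
  {ω | ∀ u ∈ V, (∀ v ∈ V, |∑ i, (⟪u, X i ω⟫ * ⟪v, X i ω⟫ - ∫ ω, ⟪u, X i ω⟫ * ⟪v, X i ω⟫ ∂P)| ≤
    n * t) ∧ |∑ i, ⟪u, X i ω⟫| ≤ n * t}

theorem measurableSet_empiricalMomentEvent {n : ℕ} {X : Fin n → Ω → E}
    (hX : ∀ i, Measurable (X i)) (V : Finset E) (t : ℝ) :
    MeasurableSet (empiricalMomentEvent P X V t) := by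
  simp only [empiricalMomentEvent, Set.ofPred_forall, Set.ofPred_and]
  refine V.measurableSet_biInter fun u _ => .inter (V.measurableSet_biInter fun v _ => ?_) ?_
  all_goals exact measurableSet_le (by fun_prop) (by fun_prop)

/-- A union bound over three kinds of failure: a marginal exceeding `r = c/(2l)`, a large deviation
for a pair of directions, and one for a mean. If no marginal exceeds `r`, all products stay below
the truncation level `r²`. -/
theorem measureReal_compl_empiricalMomentEvent_le {n : ℕ} {X : Fin n → Ω → E}
    (hind : iIndepFun X P) (hmean : ∀ i u, ∫ ω, ⟪u, X i ω⟫ ∂P = 0)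
    {V : Finset E} {c M l : ℝ} (hc : 0 < c)
    (hexp : ∀ i, ∀ u ∈ V, HasExpMoment P (fun ω => ⟪u, X i ω⟫) c M)
    (hM : Real.exp c ≤ M) (hl : 0 < l) (hl1 : l ≤ 1) (hlc : l ≤ c / 2) (t : ℝ) :
    P.real (empiricalMomentEvent P X V t)ᶜ ≤
      n * V.card * (M * Real.exp (-c * (c / 2 / l))) +
      (V.card ^ 2 + V.card) * (2 * Real.exp (-l * (n * t) +
        n * (l ^ 2 * (384 / c ^ 4 * M * (1 + ((c / 2) ^ 2)⁻¹))))) := by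
  set r := c / 2 / l with hr
  have hr1 : 1 ≤ r := by rw [hr, one_le_div hl]; exact hlc
  set Q := 2 * Real.exp (-l * (n * t) +
        n * (l ^ 2 * (384 / c ^ 4 * M * (1 + ((c / 2) ^ 2)⁻¹))))
  -- Means are treated as products with the constant 1, so one inequality serves both cases; this
  -- needs `exp c ≤ M`, and `1 ≤ r` to have `r ≤ r²`.
  have hone : HasExpMoment P (fun _ => (1 : ℝ)) c M :=
    ⟨measurable_const, integrable_const _, by simpa using hM⟩
  let S₁ : Fin n → E → Set Ω := fun i u => {ω | r < |⟪u, X i ω⟫|}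
  let S₂ : E → E → Set Ω := fun u v => {ω | (∀ i, |⟪u, X i ω⟫ * ⟪v, X i ω⟫| ≤ r ^ 2) ∧
    n * t ≤ |∑ i, (⟪u, X i ω⟫ * ⟪v, X i ω⟫ - ∫ ω, ⟪u, X i ω⟫ * ⟪v, X i ω⟫ ∂P)|}
  let S₃ : E → Set Ω := fun u => {ω | (∀ i, |⟪u, X i ω⟫ * 1| ≤ r ^ 2) ∧
    n * t ≤ |∑ i, (⟪u, X i ω⟫ * 1 - ∫ ω, ⟪u, X i ω⟫ * 1 ∂P)|}
  have h₁ (i : Fin n) : ∀ u ∈ V, P.real (S₁ i u) ≤ M * Real.exp (-c * r) := fun u hu =>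
    (hexp i u hu).measureReal_lt_abs_le hc r
  have h₂ : ∀ u ∈ V, ∀ v ∈ V, P.real (S₂ u v) ≤ Q := fun u hu v hv =>
    measureReal_abs_sum_sub_ge_le (half_pos hc)
      (fun i => (hexp i u hu).mul hc (hexp i v hv))
      (hind.comp (fun _ x => ⟪u, x⟫ * ⟪v, x⟫) fun _ => by fun_prop) hl hl1 t
  have h₃ : ∀ u ∈ V, P.real (S₃ u) ≤ Q := fun u hu =>
    measureReal_abs_sum_sub_ge_le (half_pos hc)
      (fun i => (hexp i u hu).mul hc hone)
      (hind.comp (fun _ x => ⟪u, x⟫ * 1) fun _ => by fun_prop) hl hl1 t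
  have hsub : (empiricalMomentEvent P X V t)ᶜ ⊆ (⋃ i ∈ Finset.univ, ⋃ u ∈ V, S₁ i u) ∪
      ((⋃ u ∈ V, ⋃ v ∈ V, S₂ u v) ∪ ⋃ u ∈ V, S₃ u) := by
    intro ω hω
    by_contra hcon
    simp only [Set.mem_union, Set.mem_iUnion, not_or, not_exists] at hcon
    obtain ⟨n₁, n₂, n₃⟩ := hcon
    refine hω fun u hu => ?_
    have b (u : E) (hu : u ∈ V) (i : Fin n) : |⟪u, X i ω⟫| ≤ r :=
      not_lt.1 (n₁ i (Finset.mem_univ i) u hu)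
    refine ⟨fun v hv => ?_, ?_⟩
    · by_contra! h
      refine n₂ u hu v hv ⟨fun i => ?_, h.le⟩
      rw [abs_mul, sq]
      gcongr
      exacts [b u hu i, b v hv i]
    · by_contra! h
      refine n₃ u hu ⟨fun i => ?_, ?_⟩
      · rw [mul_one]
        refine (b u hu i).trans ?_
        nlinarith
      · simpa only [mul_one, hmean, sub_zero] using h.le
  refine (measureReal_mono hsub).trans ((measureReal_union_le _ _).trans (add_le_add ?_
    ((measureReal_union_le _ _).trans ?_)))
  · refine (measureReal_biUnion_finset_le _ _).trans ?_
    have : ∀ i ∈ Finset.univ, P.real (⋃ u ∈ V, S₁ i u) ≤ V.card * (M * Real.exp (-c * r)) :=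
      fun i _ => (measureReal_biUnion_finset_le _ _).trans
        ((Finset.sum_le_card_nsmul _ _ _ (h₁ i)).trans_eq (nsmul_eq_mul _ _))
    refine (Finset.sum_le_card_nsmul _ _ _ this).trans_eq ?_
    simp [mul_assoc]
  · rw [add_mul, sq, mul_assoc]
    refine add_le_add ?_ ?_
    · refine (measureReal_biUnion_finset_le _ _).trans ?_
      have : ∀ u ∈ V, P.real (⋃ v ∈ V, S₂ u v) ≤ V.card * Q :=
        fun u hu => (measureReal_biUnion_finset_le _ _).trans
          ((Finset.sum_le_card_nsmul _ _ _ (h₂ u hu)).trans_eq (nsmul_eq_mul _ _))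
      exact (Finset.sum_le_card_nsmul _ _ _ this).trans_eq (nsmul_eq_mul _ _)
    · exact (measureReal_biUnion_finset_le _ _).trans
          ((Finset.sum_le_card_nsmul _ _ _ h₃).trans_eq (nsmul_eq_mul _ _))

end Concentration

/-- The conditional distribution of `f (X, Z)` given `X`, for independent `X` and `Z`. -/
theorem condDistrib_comp_prodMk_of_indepFun {Ω α β γ : Type*} [MeasurableSpace Ω]
    [MeasurableSpace α] [MeasurableSpace β] [MeasurableSpace γ] [StandardBorelSpace γ] [Nonempty γ]
    {P : Measure Ω} [IsProbabilityMeasure P] {X : Ω → α} {Z : Ω → β} (hX : Measurable X)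
    (hZ : AEMeasurable Z P) (hind : IndepFun X Z P) {f : α × β → γ} (hf : Measurable f) :
    ∀ᵐ ω ∂P, condDistrib (fun ω => f (X ω, Z ω)) X P (X ω) = P.map fun ω' => f (X ω, Z ω') := by
  have : IsProbabilityMeasure (P.map Z) := Measure.isProbabilityMeasure_map hZ
  have : IsProbabilityMeasure (P.map X) := Measure.isProbabilityMeasure_map hX.aemeasurable
  -- By independence, fixing `X = x` does not change the law of `Z`, so the law of `f (x, Z)` is the
  -- candidate; almost sure uniqueness of the disintegration identifies it.
  set κ : Kernel α γ := (Kernel.id ×ₖ Kernel.const α (P.map Z)).map f with hκ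
  have hκa (x : α) : κ x = P.map fun ω => f (x, Z ω) := by
    rw [hκ, Kernel.map_apply _ hf, Kernel.prod_apply, Kernel.id_apply, Kernel.const_apply,
      Measure.dirac_prod, Measure.map_map hf measurable_prodMk_left,
      AEMeasurable.map_map_of_aemeasurable
        (hf.comp measurable_prodMk_left).aemeasurable hZ]
    rfl
  have hmap := (indepFun_iff_map_prod_eq_prod_map_map hX.aemeasurable hZ).1 hind
  have hfX : Measurable fun z : α × β => (z.1, f z) := measurable_fst.prodMk hf
  have hXZ : AEMeasurable (fun ω => (X ω, Z ω)) P := hX.aemeasurable.prodMk hZ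
  have hcomp : P.map (fun ω => (X ω, f (X ω, Z ω))) = P.map X ⊗ₘ κ := by
    have h1 : P.map (fun ω => (X ω, f (X ω, Z ω))) =
        ((P.map X).prod (P.map Z)).map fun z => (z.1, f z) := by
      rw [← hmap, AEMeasurable.map_map_of_aemeasurable hfX.aemeasurable hXZ]
      rfl
    ext s hs
    rw [h1, Measure.map_apply hfX hs, Measure.prod_apply (hfX hs), Measure.compProd_apply hs]
    refine lintegral_congr fun x => ?_
    rw [hκ, Kernel.map_apply' _ hf _ (measurable_prodMk_left hs), Kernel.prod_apply,
      Kernel.id_apply, Kernel.const_apply, Measure.dirac_prod,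
      Measure.map_apply measurable_prodMk_left (hf (measurable_prodMk_left hs))]
    rfl
  have h := condDistrib_ae_eq_of_measure_eq_compProd X (hf.comp_aemeasurable hXZ) hcomp
  filter_upwards [ae_of_ae_map hX.aemeasurable h] with ω hω
  rw [← hκa]
  exact hω

/-! ### Normalized sums of independent Gaussian vectors -/

section NormalizedSum

variable {p n : ℕ} {Ω : Type*} [MeasurableSpace Ω] {P : Measure Ω} [IsProbabilityMeasure P]
  {Z : Fin n → Ω → EuclideanSpace ℝ (Fin p)}

theorem hasGaussianLaw_normalizedSum (hZ : ∀ i, HasGaussianLaw (Z i) P) (hind : iIndepFun Z P) :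
    HasGaussianLaw (normalizedSum Z) P :=
  (iIndepFun.hasGaussianLaw_fun_sum hZ hind).fun_smul (√(n : ℝ))⁻¹

theorem integral_id_map_normalizedSum (hZ : ∀ i, HasGaussianLaw (Z i) P)
    (hind : iIndepFun Z P) (hmean : ∀ i, ∫ ω, Z i ω ∂P = 0) :
    ∫ z, z ∂(P.map (normalizedSum Z)) = 0 := by
  rw [integral_map (hasGaussianLaw_normalizedSum hZ hind).aemeasurable (by fun_prop)]
  simp only [normalizedSum]
  rw [integral_smul, integral_finsetSum _ fun i _ => (hZ i).integrable]
  simp [hmean]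

theorem integral_inner_mul_inner_map_normalizedSum (hZ : ∀ i, HasGaussianLaw (Z i) P)
    (hind : iIndepFun Z P) (hmean : ∀ i, ∫ ω, Z i ω ∂P = 0)
    (u v : EuclideanSpace ℝ (Fin p)) :
    ∫ z, ⟪u, z⟫ * ⟪v, z⟫ ∂(P.map (normalizedSum Z)) =
      (n : ℝ)⁻¹ * ∑ i, ∫ ω, ⟪u, Z i ω⟫ * ⟪v, Z i ω⟫ ∂P := by
  have hL (u : EuclideanSpace ℝ (Fin p)) (i : Fin n) : MemLp (fun ω => ⟪u, Z i ω⟫) 2 P :=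
    ((hZ i).map_fun (innerSL ℝ u)).memLp_two
  have hint (i j : Fin n) : Integrable (fun ω => ⟪u, Z i ω⟫ * ⟪v, Z j ω⟫) P :=
    (hL u i).integrable_mul (hL v j)
  have hmean' (i : Fin n) : ∫ ω, ⟪u, Z i ω⟫ ∂P = 0 := by
    rw [integral_inner (hZ i).integrable, hmean, inner_zero_right]
  have hcross (i j : Fin n) (hij : i ≠ j) : ∫ ω, ⟪u, Z i ω⟫ * ⟪v, Z j ω⟫ ∂P = 0 := by
    have h : IndepFun (fun ω => ⟪u, Z i ω⟫) (fun ω => ⟪v, Z j ω⟫) P :=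
      (hind.indepFun hij).comp (φ := fun x => ⟪u, x⟫) (ψ := fun x => ⟪v, x⟫)
        (by fun_prop) (by fun_prop)
    rw [h.integral_fun_mul_eq_mul_integral (hL u i).aestronglyMeasurable
      (hL v j).aestronglyMeasurable, hmean', zero_mul]
  rw [integral_map (hasGaussianLaw_normalizedSum hZ hind).aemeasurable
    (Continuous.aestronglyMeasurable (by fun_prop))]
  have e (ω : Ω) : ⟪u, normalizedSum Z ω⟫ * ⟪v, normalizedSum Z ω⟫ =
      (n : ℝ)⁻¹ * ∑ i, ∑ j, ⟪u, Z i ω⟫ * ⟪v, Z j ω⟫ := by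
    simp only [normalizedSum, inner_smul_right, inner_sum]
    rw [← Finset.sum_mul_sum, ← Real.sqrt_inv]
    have h := Real.mul_self_sqrt (inv_nonneg.2 (Nat.cast_nonneg n : (0 : ℝ) ≤ n))
    linear_combination (∑ i, ⟪u, Z i ω⟫) * (∑ j, ⟪v, Z j ω⟫) * h
  simp_rw [e]
  rw [integral_const_mul, integral_finsetSum _ fun i _ => integrable_finsetSum _ fun j _ =>
    hint i j]
  congr 1
  refine Finset.sum_congr rfl fun i _ => ?_
  rw [integral_finsetSum _ fun j _ => hint i j]
  exact Finset.sum_eq_single i (fun j _ hj => hcross i j hj.symm) (by simp)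

end NormalizedSum

theorem sum_inner_sub_mean_mul {E : Type*} [NormedAddCommGroup E] [InnerProductSpace ℝ E] {n : ℕ}
    (hn : n ≠ 0) (x : Fin n → E) (u v : E) :
    ∑ i, ⟪u, x i - (n : ℝ)⁻¹ • ∑ j, x j⟫ * ⟪v, x i - (n : ℝ)⁻¹ • ∑ j, x j⟫ =
      ∑ i, ⟪u, x i⟫ * ⟪v, x i⟫ - (n : ℝ)⁻¹ * ((∑ i, ⟪u, x i⟫) * ∑ i, ⟪v, x i⟫) := by
  have hn' : (n : ℝ) ≠ 0 := Nat.cast_ne_zero.2 hn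
  simp only [inner_sub_right, inner_smul_right, inner_sum, sub_mul, mul_sub,
    Finset.sum_sub_distrib, ← Finset.sum_mul, ← Finset.mul_sum, Finset.sum_const,
    Finset.card_univ, Fintype.card_fin, nsmul_eq_mul]
  field_simp
  ring

/-! ### The conditional law of the multiplier sum -/

section Bootstrap

variable {p n : ℕ} {Ω : Type*} [MeasurableSpace Ω] {P : Measure Ω} [IsProbabilityMeasure P]
  {e : Fin n → Ω → ℝ}

/-- The law of the multiplier sum with fixed observations is centered Gaussian. -/
theorem gaussian_multiplierSum (hind : iIndepFun e P)
    (he : ∀ i, HasLaw (e i) (gaussianReal 0 1) P) (y : Fin n → EuclideanSpace ℝ (Fin p)) :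
    IsGaussian (P.map (normalizedSum fun i ω => e i ω • y i)) ∧
    ∫ z, z ∂(P.map (normalizedSum fun i ω => e i ω • y i)) = 0 ∧
    ∀ u v, ∫ z, ⟪u, z⟫ * ⟪v, z⟫ ∂(P.map (normalizedSum fun i ω => e i ω • y i)) =
      (n : ℝ)⁻¹ * ∑ i, ⟪u, y i⟫ * ⟪v, y i⟫ := by
  have h0 (i : Fin n) : ∫ ω, e i ω ∂P = 0 := by
    rw [(he i).integral_eq, integral_id_gaussianReal]
  have h2 (i : Fin n) : ∫ ω, e i ω ^ 2 ∂P = 1 := by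
    have h := (he i).variance_eq
    rw [variance_id_gaussianReal, variance_of_integral_eq_zero (he i).aemeasurable (h0 i)] at h
    simpa using h
  have hZ (i : Fin n) : HasGaussianLaw (fun ω => e i ω • y i) P :=
    (he i).hasGaussianLaw.map_fun ((ContinuousLinearMap.id ℝ ℝ).smulRight (y i))
  have hZind : iIndepFun (fun i ω => e i ω • y i) P :=
    hind.comp (fun i x => x • y i) fun i => by fun_prop
  have hmean (i : Fin n) : ∫ ω, e i ω • y i ∂P = 0 := by
    rw [integral_smul_const, h0, zero_smul]
  refine ⟨(hasGaussianLaw_normalizedSum hZ hZind).isGaussian_map,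
    integral_id_map_normalizedSum hZ hZind hmean, fun u v => ?_⟩
  rw [integral_inner_mul_inner_map_normalizedSum hZ hZind hmean]
  congr 1
  refine Finset.sum_congr rfl fun i _ => ?_
  simp_rw [inner_smul_right, mul_mul_mul_comm, ← sq (e i _)]
  rw [integral_mul_const, h2, one_mul]

theorem condDistrib_bootstrapSum {X : Fin n → Ω → EuclideanSpace ℝ (Fin p)}
    (hX : ∀ i, Measurable (X i)) (he : ∀ i, AEMeasurable (e i) P)
    (hind : IndepFun (fun ω i => e i ω) (fun ω i => X i ω) P) :
    ∀ᵐ ω ∂P, condDistrib (bootstrapSum X e) (fun ω i => X i ω) P (fun i => X i ω) =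
      P.map (normalizedSum fun i ω' => e i ω' • (X i ω - sampleMean X ω)) := by
  have hf : Measurable fun z : (Fin n → EuclideanSpace ℝ (Fin p)) × (Fin n → ℝ) =>
      (√(n : ℝ))⁻¹ • ∑ i, z.2 i • (z.1 i - (n : ℝ)⁻¹ • ∑ j, z.1 j) := by fun_prop
  exact condDistrib_comp_prodMk_of_indepFun (X := fun ω i => X i ω) (Z := fun ω i => e i ω)
    (measurable_pi_lambda _ hX) (aemeasurable_pi_lambda _ he) hind.symm hf

end Bootstrap

/-! ### Reduction of simple sets to polyhedra with finite offsets -/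

section Polytope

variable {p n : ℕ}

/-- Support functions may be infinite. If `K` is empty, there is a normal and its support value is
`-∞`, so the enlargement is empty too. Otherwise the normals with support value `+∞` impose no
constraint and are dropped; if none remains, the set is the whole space. In both degenerate cases
all probability measures agree on `A`. -/
theorem IsSimpleApprox.exists_polyhedron {a d : ℝ}
    {A K : Set (EuclideanSpace ℝ (Fin p))} {V : Finset (EuclideanSpace ℝ (Fin p))}
    (h : IsSimpleApprox p n a d A K V) :
    A = ∅ ∨ A = Set.univ ∨ ∃ V' ⊆ V, V'.Nonempty ∧ ∃ b : V' → ℝ,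
      {z | ∀ v : V', ⟪(v : EuclideanSpace ℝ (Fin p)), z⟫ ≤ b v} ⊆ A ∧
      A ⊆ {z | ∀ v : V', ⟪(v : EuclideanSpace ℝ (Fin p)), z⟫ ≤ b v + a / n} := by
  classical
  rcases K.eq_empty_or_nonempty with hK | ⟨w₀, hw₀⟩
  · left
    have hV : ∃ v, v ∈ V := by
      by_contra! hV
      have h1 := h.generated.eq_inter
      rw [hK] at h1
      have h2 : (0 : EuclideanSpace ℝ (Fin p)) ∈ (∅ : Set (EuclideanSpace ℝ (Fin p))) := by
        rw [h1]
        exact fun v hv => absurd hv (hV v)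
      exact h2
    obtain ⟨v, hv⟩ := hV
    refine Set.eq_empty_of_forall_notMem fun w hw => ?_
    have h1 := h.subset_right hw v hv
    simp [supportFun, hK] at h1
  · right
    have hbot (v : EuclideanSpace ℝ (Fin p)) : supportFun K v ≠ ⊥ := by
      refine ne_of_gt (lt_of_lt_of_le (EReal.bot_lt_coe ⟪w₀, v⟫) ?_)
      exact le_iSup₂_of_le w₀ hw₀ le_rfl
    set V' := V.filter fun v => supportFun K v ≠ ⊤ with hV'
    have hb (v : V') : ((supportFun K v).toReal : EReal) = supportFun K v :=
      EReal.coe_toReal (Finset.mem_filter.1 v.2).2 (hbot v)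
    have hKA : {z | ∀ v : V', ⟪(v : EuclideanSpace ℝ (Fin p)), z⟫ ≤ (supportFun K v).toReal} ⊆
        A := by
      refine subset_trans (fun z hz => ?_) h.subset_left
      rw [h.generated.eq_inter]
      intro v hv
      by_cases hvt : supportFun K v = ⊤
      · rw [hvt]
        exact le_top
      · have h1 := hz ⟨v, Finset.mem_filter.2 ⟨hv, hvt⟩⟩
        rw [← hb ⟨v, Finset.mem_filter.2 ⟨hv, hvt⟩⟩, EReal.coe_le_coe_iff, real_inner_comm]
        exact h1
    rcases V'.eq_empty_or_nonempty with hem | hne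
    · left
      exact Set.eq_univ_of_forall fun z => hKA fun v => absurd v.2 (by simp [hem])
    · refine Or.inr ⟨V', Finset.filter_subset _ _, hne, fun v => (supportFun K v).toReal, hKA, ?_⟩
      intro z hz v
      have h1 := h.subset_right hz v (Finset.mem_filter.1 v.2).1
      rw [← hb v, ← EReal.coe_add, EReal.coe_le_coe_iff, real_inner_comm] at h1
      exact h1

end Polytope

/-! ### Second moment matrices, their eigenvalues and marginal variances -/

section Covariance

/-- The infimum and supremum of the Rayleigh quotient are themselves eigenvalues in finite
dimension. -/
theorem LinearMap.IsSymmetric.inner_mem_of_eigenvalues {E : Type*} [NormedAddCommGroup E]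
    [InnerProductSpace ℝ E] [FiniteDimensional ℝ E] {T : E →ₗ[ℝ] E} (hT : T.IsSymmetric)
    {k₁ k₂ : ℝ} (h : ∀ l, Module.End.HasEigenvalue T l → k₁ ≤ l ∧ l ≤ k₂) {v : E}
    (hv : ‖v‖ = 1) : k₁ ≤ ⟪T v, v⟫ ∧ ⟪T v, v⟫ ≤ k₂ := by
  have hv0 : v ≠ 0 := by rintro rfl; simp at hv
  have : Nontrivial E := ⟨v, 0, hv0⟩
  have hbd (x : E) : |⟪T x, x⟫ / ‖x‖ ^ 2| ≤ ‖LinearMap.toContinuousLinearMap T‖ := by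
    rw [abs_div, abs_of_nonneg (sq_nonneg ‖x‖)]
    refine div_le_of_le_mul₀ (by positivity) (by positivity) ?_
    refine (abs_real_inner_le_norm _ _).trans ?_
    rw [sq, ← mul_assoc]
    gcongr
    exact (LinearMap.toContinuousLinearMap T).le_opNorm x
  have e : ⟪T v, v⟫ = RCLike.re ⟪T v, v⟫ / ‖v‖ ^ 2 := by simp [hv]
  constructor
  · refine (h _ hT.hasEigenvalue_iInf_of_finiteDimensional).1.trans ?_
    rw [e]
    refine ciInf_le (f := fun x : {x : E // x ≠ 0} => RCLike.re ⟪T x, (x : E)⟫ / ‖(x : E)‖ ^ 2)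
      ⟨-‖LinearMap.toContinuousLinearMap T‖, ?_⟩ ⟨v, hv0⟩
    rintro _ ⟨x, rfl⟩
    exact (abs_le.1 (hbd x)).1
  · refine le_trans ?_ (h _ hT.hasEigenvalue_iSup_of_finiteDimensional).2
    rw [e]
    refine le_ciSup (f := fun x : {x : E // x ≠ 0} => RCLike.re ⟪T x, (x : E)⟫ / ‖(x : E)‖ ^ 2)
      ⟨‖LinearMap.toContinuousLinearMap T‖, ?_⟩ ⟨v, hv0⟩
    rintro _ ⟨x, rfl⟩
    exact (abs_le.1 (hbd x)).2

variable {p : ℕ} {Ω : Type*} [MeasurableSpace Ω] {P : Measure Ω} [IsProbabilityMeasure P]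
  {X : Ω → EuclideanSpace ℝ (Fin p)}

theorem integral_inner_mul_inner_eq_dotProduct (hX : MemLp X 2 P)
    (u v : EuclideanSpace ℝ (Fin p)) :
    ∫ ω, ⟪u, X ω⟫ * ⟪v, X ω⟫ ∂P = u.ofLp ⬝ᵥ (secondMomentMatrix P X).mulVec v.ofLp := by
  have hL (j : Fin p) : MemLp (fun ω => X ω j) 2 P :=
    (EuclideanSpace.proj (𝕜 := ℝ) j).comp_memLp' hX
  have hint (j k : Fin p) : Integrable (fun ω => u j * v k * (X ω j * X ω k)) P :=
    ((hL j).integrable_mul (hL k)).const_mul _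
  have e (ω : Ω) : ⟪u, X ω⟫ * ⟪v, X ω⟫ = ∑ j, ∑ k, u j * v k * (X ω j * X ω k) := by
    simp only [PiLp.inner_apply, RCLike.inner_apply, conj_trivial, Finset.sum_mul_sum]
    refine Finset.sum_congr rfl fun j _ => Finset.sum_congr rfl fun k _ => ?_
    ring
  simp_rw [e]
  rw [integral_finsetSum _ fun j _ => integrable_finsetSum _ fun k _ => hint j k]
  simp only [dotProduct, Matrix.mulVec, secondMomentMatrix, Matrix.of_apply, Finset.mul_sum]
  refine Finset.sum_congr rfl fun j _ => ?_
  rw [integral_finsetSum _ fun k _ => hint j k]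
  refine Finset.sum_congr rfl fun k _ => ?_
  rw [integral_const_mul]
  ring

theorem posSemidef_secondMomentMatrix (hX : MemLp X 2 P) :
    (secondMomentMatrix P X).PosSemidef := by
  refine Matrix.PosSemidef.of_dotProduct_mulVec_nonneg ?_ fun x => ?_
  · ext j k
    simp [secondMomentMatrix, mul_comm]
  · have h := integral_inner_mul_inner_eq_dotProduct hX (WithLp.toLp 2 x) (WithLp.toLp 2 x)
    simp only [star_trivial]
    rw [← h]
    exact integral_nonneg fun ω => mul_self_nonneg _

theorem integral_inner_sq_mem_of_eigenvalues (hX : MemLp X 2 P) {k₁ k₂ : ℝ}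
    (h : ∀ l, Module.End.HasEigenvalue (Matrix.toLin' (secondMomentMatrix P X)) l →
      k₁ ≤ l ∧ l ≤ k₂) {v : EuclideanSpace ℝ (Fin p)} (hv : ‖v‖ = 1) :
    k₁ ≤ ∫ ω, ⟪v, X ω⟫ ^ 2 ∂P ∧ ∫ ω, ⟪v, X ω⟫ ^ 2 ∂P ≤ k₂ := by
  set T := Matrix.toEuclideanLin (secondMomentMatrix P X) with hT
  have hsymm : T.IsSymmetric :=
    Matrix.isSymmetric_toEuclideanLin_iff.2 (posSemidef_secondMomentMatrix hX).isHermitian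
  have heig (l : ℝ) (hl : Module.End.HasEigenvalue T l) : k₁ ≤ l ∧ l ≤ k₂ := by
    refine h l ?_
    obtain ⟨x, hx⟩ := hl.exists_hasEigenvector
    refine Module.End.hasEigenvalue_of_hasEigenvector (x := x.ofLp)
      (Module.End.hasEigenvector_iff.2 ⟨Module.End.mem_eigenspace_iff.2 ?_, ?_⟩)
    · have := congrArg WithLp.ofLp hx.apply_eq_smul
      simpa [hT] using this
    · simpa using hx.2
  have key : ⟪T v, v⟫ = ∫ ω, ⟪v, X ω⟫ ^ 2 ∂P := by
    simp_rw [sq]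
    rw [integral_inner_mul_inner_eq_dotProduct hX, real_inner_comm, hT]
    simp [PiLp.inner_apply, dotProduct, mul_comm]
  rw [← key]
  exact hsymm.inner_mem_of_eigenvalues heig hv

theorem integral_inner_mul_inner_of_hasLaw {Ω' : Type*} [MeasurableSpace Ω'] {P' : Measure Ω'}
    {Y : Ω' → EuclideanSpace ℝ (Fin p)} (hX : MemLp X 2 P)
    (hY : HasLaw Y (multivariateGaussian 0 (secondMomentMatrix P X)) P')
    (u v : EuclideanSpace ℝ (Fin p)) :
    ∫ ω, ⟪u, Y ω⟫ * ⟪v, Y ω⟫ ∂P' = ∫ ω, ⟪u, X ω⟫ * ⟪v, X ω⟫ ∂P := by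
  have h1 : ∫ ω, ⟪u, Y ω⟫ * ⟪v, Y ω⟫ ∂P' =
      ∫ z, ⟪u, z⟫ * ⟪v, z⟫ ∂(multivariateGaussian 0 (secondMomentMatrix P X)) :=
    hY.integral_comp (f := fun z => ⟪u, z⟫ * ⟪v, z⟫)
      (Continuous.aestronglyMeasurable (by fun_prop))
  rw [h1, ← covarianceBilin_eq_integral_of_centered integral_id_multivariateGaussian,
    covarianceBilin_multivariateGaussian (posSemidef_secondMomentMatrix hX),
    integral_inner_mul_inner_eq_dotProduct hX]

end Covariance

/-! ### Comparison on simple sets, and the choice of parameters -/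

/-- Comparison of two Gaussian measures on an approximately polyhedral set. -/
theorem abs_gaussian_sub_le_of_isSimpleApprox {p n : ℕ} {a d d' : ℝ} (ha : 0 ≤ a) (hd : 0 < d)
    {A K : Set (EuclideanSpace ℝ (Fin p))} {V : Finset (EuclideanSpace ℝ (Fin p))}
    (h : IsSimpleApprox p n a d' A K V)
    {μ ν : Measure (EuclideanSpace ℝ (Fin p))} [IsGaussian μ] [IsGaussian ν]
    (hμ : ∫ z, z ∂μ = 0) (hν : ∫ z, z ∂ν = 0) {k : ℝ} (hk : 0 < k)
    (hvar : ∀ v ∈ V, k ≤ ∫ z, ⟪v, z⟫ ^ 2 ∂ν) {Δ : ℝ} (hΔ0 : 0 ≤ Δ)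
    (hΔ : ∀ u ∈ V, ∀ v ∈ V, |∫ z, ⟪u, z⟫ * ⟪v, z⟫ ∂μ - ∫ z, ⟪u, z⟫ * ⟪v, z⟫ ∂ν| ≤ Δ)
    {L φ : ℝ} (hL : 1 ≤ L) (hcard : (V.card : ℝ) ≤ Real.exp (d * L)) (hφ : 0 < φ) :
    |μ.real A - ν.real A| ≤
      ((d + 1) / φ + a / n) * ((√k)⁻¹ * (5 * √(2 * d) + 6) * √L) +
        2 * smoothIndicatorBound * (φ ^ 2 * L) * Δ := by
  have hB := smoothIndicatorBound_pos
  have hL0 : 0 < L := by linarith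
  rcases h.exists_polyhedron with rfl | rfl | ⟨V', hV', hne, b, hbA, hAb⟩
  · simp only [measureReal_empty, sub_self, abs_zero]
    positivity
  · simp only [probReal_univ, sub_self, abs_zero]
    positivity
  have : Nonempty V' := hne.to_subtype
  set A₀ := (√k)⁻¹ * (5 * √(2 * d) + 6) * √L with hA₀
  have hcardV : Real.log (Fintype.card V') ≤ d * L := by
    rw [Real.log_le_iff_le_exp (by exact_mod_cast Fintype.card_pos)]
    refine le_trans ?_ hcard
    rw [Fintype.card_coe]
    exact_mod_cast Finset.card_le_card hV'
  have hanti (b : V' → ℝ) (ε : ℝ) (hε : 0 ≤ ε) :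
      ν.real {z | ∀ v : V', ⟪(v : EuclideanSpace ℝ (Fin p)), z⟫ ≤ b v + ε} ≤
        ν.real {z | ∀ v : V', ⟪(v : EuclideanSpace ℝ (Fin p)), z⟫ ≤ b v} + ε * A₀ := by
    refine (gaussian_antiConcentration_of_variance_ge hν hk (fun v : V' => hvar v (hV' v.2)) b
      hε).trans ?_
    rw [hA₀, mul_assoc (√k)⁻¹]
    gcongr
    have h1 : √(2 * Real.log (Fintype.card V')) ≤ √(2 * d) * √L := by
      rw [← Real.sqrt_mul (by positivity), mul_assoc]
      gcongr
    have h2 : 1 ≤ √L := Real.one_le_sqrt.2 hL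
    linarith
  -- With `β = φ L` both smoothing errors are of order `1/φ`, because `log N ≤ d L`.
  have hcmp (b : V' → ℝ) := gaussian_comparison_polyhedron hμ hν
    (fun v : V' => (h.generated.norm_eq_one v (hV' v.2)).le)
    (fun u v : V' => hΔ u (hV' u.2) v (hV' v.2)) hanti (β := φ * L) (by positivity) hφ b
  have hQ : (Real.log (Fintype.card V') / (φ * L) + φ⁻¹) * A₀ +
      smoothIndicatorBound * (φ ^ 2 + 2 * (φ * L) * φ) * Δ / 2 ≤
      (d + 1) / φ * A₀ + 2 * smoothIndicatorBound * (φ ^ 2 * L) * Δ := by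
    gcongr ?_ * A₀ + ?_
    · calc _ ≤ d * L / (φ * L) + φ⁻¹ := by gcongr
        _ = _ := by field_simp
    · have : φ ^ 2 ≤ φ ^ 2 * L := le_mul_of_one_le_right (by positivity) hL
      calc _ ≤ smoothIndicatorBound * (φ ^ 2 * L + 2 * (φ * L) * φ) * Δ / 2 := by gcongr
        _ ≤ _ := by
          have : 0 ≤ smoothIndicatorBound * (φ ^ 2 * L) * Δ := by positivity
          linarith
  have hε : 0 ≤ a / (n : ℝ) := by positivity
  have h1 := abs_le.1 ((hcmp b).trans hQ)
  -- Both the inner and the outer polyhedron are compared; anti-concentration of `ν` bounds the mass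
  -- between them.
  have h2 := abs_le.1 ((hcmp fun v => b v + a / n).trans hQ)
  have h3 := hanti b (a / n) hε
  have m1 := measureReal_mono hbA (μ := μ)
  have m2 := measureReal_mono hAb (μ := μ)
  have m3 := measureReal_mono hbA (μ := ν)
  have m4 := measureReal_mono hAb (μ := ν)
  rw [add_mul, abs_sub_le_iff]
  constructor <;> linarith

/-- Chebyshev's inequality at the level `√(8k)` supplies the mass bound 1/8 from which Borell's
lemma starts. -/
theorem hasExpMoment_of_isLogConcave {p : ℕ} {Ω : Type*} [MeasurableSpace Ω] {P : Measure Ω}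
    [IsProbabilityMeasure P] {X : Ω → EuclideanSpace ℝ (Fin p)} (hX : Measurable X)
    (hX2 : MemLp X 2 P) (hlc : IsLogConcave (P.map X)) {k : ℝ} (hk : 0 < k)
    {v : EuclideanSpace ℝ (Fin p)} (hv : ∫ ω, ⟪v, X ω⟫ ^ 2 ∂P ≤ k) :
    HasExpMoment P (fun ω => ⟪v, X ω⟫) (4 * √(8 * k))⁻¹ logConcaveExpBound := by
  have : IsProbabilityMeasure (P.map X) := Measure.isProbabilityMeasure_map hX.aemeasurable
  have hs : 0 < √(8 * k) := by positivity
  have hL : MemLp (fun ω => ⟪v, X ω⟫) 2 P := (innerSL ℝ v).comp_memLp' hX2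
  have h8 : (P.map X).real {x | √(8 * k) ≤ |⟪v, x⟫|} ≤ 1 / 8 := by
    rw [map_measureReal_apply hX (isClosed_le (by fun_prop) (by fun_prop)).measurableSet]
    have h := mul_meas_ge_le_integral_of_nonneg (μ := P) (f := fun ω => ⟪v, X ω⟫ ^ 2)
      (ae_of_all _ fun ω => sq_nonneg _) hL.integrable_sq (8 * k)
    have e : X ⁻¹' {x | √(8 * k) ≤ |⟪v, x⟫|} = {ω | 8 * k ≤ ⟪v, X ω⟫ ^ 2} := by
      ext ω
      simp only [Set.mem_preimage, Set.mem_ofPred_eq]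
      rw [Real.sqrt_le_left (abs_nonneg _), sq_abs]
    rw [e]
    have := h.trans hv
    rw [le_div_iff₀ (by norm_num)]
    nlinarith
  obtain ⟨h1, h2⟩ := hlc.exp_moment v hs h8
  have hc : Continuous fun x : EuclideanSpace ℝ (Fin p) =>
      Real.exp ((4 * √(8 * k))⁻¹ * |⟪v, x⟫|) := by fun_prop
  refine ⟨by fun_prop, ?_, ?_⟩
  · exact h1.comp_measurable hX
  · rwa [integral_map hX.aemeasurable hc.aestronglyMeasurable] at h2

/-- The numerical tail estimate for the union bound. -/
theorem tail_sum_le_exp_neg {n N d c M K L l t lam D : ℝ} (hnL : n ≤ Real.exp L)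
    (hN : 0 ≤ N) (hNL : N ≤ Real.exp (d * L)) (hd : 0 < d) (hc : 0 < c) (hM : 1 ≤ M) (hK : 0 ≤ K)
    (hL : 1 ≤ L) (hl : 1 ≤ l) (hD : 2 * (3 + d + Real.log M) / c ^ 2 ≤ D)
    (hlam0 : 0 < lam) (hlam : D * (L ^ 2 * l) ≤ lam⁻¹) (hlamL : n * lam ^ 2 = L)
    (ht : t = (2 * d + K + 4) * lam * l) :
    n * N * (M * Real.exp (-c * (c / 2 / lam))) +
      (N ^ 2 + N) * (2 * Real.exp (-lam * (n * t) + n * (lam ^ 2 * K))) ≤ Real.exp (-l) := by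
  have hlogM : 0 ≤ Real.log M := Real.log_nonneg hM
  have hLl : 1 ≤ L * l := by nlinarith
  have hL2l : L * l ≤ L ^ 2 * l := by nlinarith
  have h1 : n * N * (M * Real.exp (-c * (c / 2 / lam))) ≤ Real.exp (-l - 1) := by
    calc _ ≤ Real.exp L * Real.exp (d * L) * (Real.exp (Real.log M) *
          Real.exp (-c * (c / 2 / lam))) := by
          rw [Real.exp_log (by linarith)]
          gcongr
      _ = Real.exp (L + d * L + (Real.log M + -c * (c / 2 / lam))) := by
          rw [Real.exp_add, Real.exp_add, Real.exp_add]
      _ ≤ _ := by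
          refine Real.exp_le_exp.2 ?_
          have e : c * (c / 2 / lam) = c ^ 2 / 2 * lam⁻¹ := by field_simp
          have h2 : (3 + d + Real.log M) * (L ^ 2 * l) ≤ c * (c / 2 / lam) := by
            rw [e]
            calc _ = c ^ 2 / 2 * (2 * (3 + d + Real.log M) / c ^ 2 * (L ^ 2 * l)) := by field_simp
              _ ≤ c ^ 2 / 2 * (D * (L ^ 2 * l)) := by gcongr
              _ ≤ _ := by gcongr
          have h3 : L ≤ L ^ 2 * l := by nlinarith
          have h4 : l ≤ L ^ 2 * l := by nlinarith
          have h5 : (1 : ℝ) ≤ L ^ 2 * l := by linarith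
          nlinarith
  have h2 : (N ^ 2 + N) * (2 * Real.exp (-lam * (n * t) + n * (lam ^ 2 * K))) ≤
      Real.exp (-l - 1) := by
    have hNe : N ^ 2 + N ≤ 2 * Real.exp (2 * (d * L)) := by
      have h3 : N ^ 2 ≤ Real.exp (2 * (d * L)) := by
        rw [two_mul, Real.exp_add, sq]
        gcongr
      have h4 : N ≤ Real.exp (2 * (d * L)) :=
        hNL.trans (Real.exp_le_exp.2 (by nlinarith [mul_pos hd (by linarith : 0 < L)]))
      linarith
    have h4 : (4 : ℝ) ≤ Real.exp 2 := by
      have := Real.add_one_le_exp (1 : ℝ)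
      rw [show (2 : ℝ) = 1 + 1 by norm_num, Real.exp_add]
      nlinarith
    have e : -lam * (n * t) + n * (lam ^ 2 * K) = -((2 * d + K + 4) * (L * l)) + L * K := by
      rw [ht, ← hlamL]
      ring
    rw [e]
    calc _ ≤ 2 * Real.exp (2 * (d * L)) *
          (2 * Real.exp (-((2 * d + K + 4) * (L * l)) + L * K)) := by gcongr
      _ = 4 * (Real.exp (2 * (d * L)) * Real.exp (-((2 * d + K + 4) * (L * l)) + L * K)) := by ring
      _ ≤ Real.exp 2 * (Real.exp (2 * (d * L)) *
          Real.exp (-((2 * d + K + 4) * (L * l)) + L * K)) := by gcongr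
      _ = Real.exp (2 + (2 * (d * L) + (-((2 * d + K + 4) * (L * l)) + L * K))) := by
          rw [← Real.exp_add (2 * (d * L)), ← Real.exp_add 2]
      _ ≤ _ := by
          refine Real.exp_le_exp.2 ?_
          have h3 : L ≤ L * l := by nlinarith
          have h5 : l ≤ L * l := by nlinarith
          nlinarith
  -- Each of the two failure terms was bounded by `exp (-l - 1)`, and `2 ≤ e`.
  have h3 : 2 * Real.exp (-l - 1) ≤ Real.exp (-l) := by
    have h4 : Real.exp (-l) = Real.exp (-l - 1) * Real.exp 1 := by
      rw [← Real.exp_add]; ring_nf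
    have := Real.add_one_le_exp (1 : ℝ)
    rw [h4]
    nlinarith [Real.exp_pos (-l - 1)]
  linarith

/-- On the event that empirical moments are close to their expectations, the covariances of the
bootstrap distribution and of its Gaussian target are close. -/
theorem abs_bootstrap_covariance_sub_le {p n : ℕ} (hn : n ≠ 0) {Ω : Type*} [MeasurableSpace Ω]
    {P : Measure Ω} {X : Fin n → Ω → EuclideanSpace ℝ (Fin p)}
    {V : Finset (EuclideanSpace ℝ (Fin p))} {t : ℝ} (ht1 : t ≤ 1) {ω : Ω}
    (hω : ω ∈ empiricalMomentEvent P X V t) {u v : EuclideanSpace ℝ (Fin p)} (hu : u ∈ V)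
    (hv : v ∈ V) :
    |(n : ℝ)⁻¹ * ∑ i, ⟪u, X i ω - sampleMean X ω⟫ * ⟪v, X i ω - sampleMean X ω⟫ -
      (n : ℝ)⁻¹ * ∑ i, ∫ ω, ⟪u, X i ω⟫ * ⟪v, X i ω⟫ ∂P| ≤ 2 * t := by
  have hn' : (0 : ℝ) < n := by positivity
  have h1 := (hω u hu).1 v hv
  have h2 := (hω u hu).2
  have h3 := (hω v hv).2
  rw [Finset.sum_sub_distrib] at h1
  simp only [sampleMean]
  rw [sum_inner_sub_mean_mul hn]
  generalize ∑ i, ⟪u, X i ω⟫ * ⟪v, X i ω⟫ = S at *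
  generalize ∑ i, ∫ ω, ⟪u, X i ω⟫ * ⟪v, X i ω⟫ ∂P = S' at *
  generalize ∑ i, ⟪u, X i ω⟫ = s at *
  generalize ∑ i, ⟪v, X i ω⟫ = s' at *
  have ht0 : 0 ≤ t := by
    by_contra! h
    nlinarith [abs_nonneg s]
  have e : (n : ℝ)⁻¹ * (S - (n : ℝ)⁻¹ * (s * s')) - (n : ℝ)⁻¹ * S' =
      (n : ℝ)⁻¹ * (S - S') - ((n : ℝ)⁻¹ * s) * ((n : ℝ)⁻¹ * s') := by ring
  have hb {x : ℝ} (hx : |x| ≤ n * t) : |(n : ℝ)⁻¹ * x| ≤ t := by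
    rw [abs_mul, abs_of_pos (inv_pos.2 hn'), inv_mul_le_iff₀ hn']
    exact hx
  rw [e]
  refine (abs_sub _ _).trans ?_
  rw [abs_mul ((n : ℝ)⁻¹ * s)]
  have h4 := mul_le_mul (hb h2) (hb h3) (abs_nonneg _) ht0
  have h5 := hb h1
  -- Centering at the sample mean contributes at most `t²`, which is at most `t` because `t ≤ 1`.
  nlinarith

/-- The closeness constant of the empirical moments. -/
noncomputable def momentConst (d c M : ℝ) : ℝ :=
  2 * d + 384 / c ^ 4 * M * (1 + ((c / 2) ^ 2)⁻¹) + 4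

/-- The constant of the regime in which the bound is not trivial. -/
noncomputable def regimeConst (d c M : ℝ) : ℝ :=
  2 * (3 + d + Real.log M) / c ^ 2 + 2 / c + momentConst d c M + 1

theorem momentConst_pos {d c M : ℝ} (hd : 0 < d) (hc : 0 < c) (hM : 1 ≤ M) :
    0 < momentConst d c M := by
  unfold momentConst
  have : 0 < M := by linarith
  positivity

theorem mainTheorem8 (a d k₁ k₂ : ℝ) (ha : 0 ≤ a) (hd : 0 < d) (hk₁ : 0 < k₁) (hk₂ : k₁ ≤ k₂) :
    ∃ C : ℝ, 0 < C ∧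
      ∀ (n p : ℕ), 4 ≤ n → 3 ≤ p →
      ∀ (Ω Ω' : Type*) [MeasurableSpace Ω] [MeasurableSpace Ω']
        (P : Measure Ω) [IsProbabilityMeasure P] (P' : Measure Ω') [IsProbabilityMeasure P']
        (X : Fin n → Ω → EuclideanSpace ℝ (Fin p))
        (Y : Fin n → Ω' → EuclideanSpace ℝ (Fin p))
        (e : Fin n → Ω → ℝ),
      -- the observations: independent, centered, log-concave
      (∀ i, Measurable (X i)) →
      iIndepFun X P →
      (∀ i, MemLp (X i) 2 P) →
      (∀ i, ∫ ω, X i ω ∂P = 0) →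
      (∀ i, IsLogConcave (P.map (X i))) →
      (∀ i, ∀ l : ℝ,
        Module.End.HasEigenvalue (Matrix.toLin' (secondMomentMatrix P (X i))) l →
          k₁ ≤ l ∧ l ≤ k₂) →
      -- the Gaussian analogues: independent, centered, with the same covariance matrices
      iIndepFun Y P' →
      (∀ i, HasLaw (Y i) (multivariateGaussian 0 (secondMomentMatrix P (X i))) P') →
      -- the multipliers: i.i.d. standard normal, independent of the observations
      iIndepFun e P →
      (∀ i, HasLaw (e i) (gaussianReal 0 1) P) →
      IndepFun (fun ω i => e i ω) (fun ω i => X i ω) P →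
      -- the class of sets, with the approximating polytopes `K A` and their normals `V A`
      ∀ 𝒜 : Set (Set (EuclideanSpace ℝ (Fin p))), 𝒜 ⊆ simpleConvexSets p n a d →
      ∀ (K : Set (EuclideanSpace ℝ (Fin p)) → Set (EuclideanSpace ℝ (Fin p)))
        (V : Set (EuclideanSpace ℝ (Fin p)) → Finset (EuclideanSpace ℝ (Fin p))),
      (∀ A ∈ 𝒜, IsSimpleApprox p n a d A (K A) (V A)) →
      (⋃ A ∈ 𝒜, (V A : Set (EuclideanSpace ℝ (Fin p)))).Finite →
      ((⋃ A ∈ 𝒜, (V A : Set (EuclideanSpace ℝ (Fin p)))).ncard : ℝ) ≤ ((p : ℝ) * n) ^ d →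
      ∀ α : ℝ, 0 < α → α < Real.exp (-1) →
      -- with probability at least `1 - α`
      ∃ E : Set Ω, MeasurableSet E ∧ ENNReal.ofReal (1 - α) ≤ P E ∧
        ∀ ω ∈ E, rhoMB P P' X e Y 𝒜 ω ≤
          C * (n : ℝ) ^ (-(1 / 6) : ℝ) * Real.log ((p : ℝ) * n) ^ (5 / 6 : ℝ) *
            Real.log (1 / α) ^ (1 / 3 : ℝ) := by
  have hk₂0 : 0 < k₂ := hk₁.trans_le hk₂
  set c : ℝ := (4 * √(8 * k₂))⁻¹ with hc
  have hc0 : 0 < c := by positivity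
  -- The second entry makes `M` also bound the exponential moment of the constant 1.
  set M : ℝ := max logConcaveExpBound (Real.exp c) with hM
  have hM1 : 1 ≤ M := (Real.one_le_exp hc0.le).trans (le_max_right _ _)
  set C₁ := momentConst d c M with hC₁
  have hC₁0 : 0 < C₁ := momentConst_pos hd hc0 hM1
  set D := regimeConst d c M with hD
  have hDsub : 0 ≤ 2 * (3 + d + Real.log M) / c ^ 2 := by
    have := Real.log_nonneg hM1
    positivity
  have hDc : 0 < 2 / c := by positivity
  have hD1 : 1 ≤ D := by simp only [hD, regimeConst, ← hC₁]; linarith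
  have hDC₁ : C₁ ≤ D := by simp only [hD, regimeConst, ← hC₁]; linarith
  have hDc' : 2 / c ≤ D := by simp only [hD, regimeConst, ← hC₁]; linarith
  have hDM : 2 * (3 + d + Real.log M) / c ^ 2 ≤ D := by
    simp only [hD, regimeConst, ← hC₁]; linarith
  set κ := (√k₁)⁻¹ * (5 * √(2 * d) + 6) with hκ
  have hκ0 : 0 < κ := by positivity
  have hB := smoothIndicatorBound_pos
  -- The parts account for smoothing (`d + 1`), the polytope gap (`a`), the covariance error and the
  -- trivial regime (`D`).
  refine ⟨(d + 1 + a) * κ + 4 * smoothIndicatorBound * C₁ + D, by positivity, ?_⟩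
  intro n p hn hp Ω Ω' _ _ P _ P' _ X Y e hXm hXind hX2 hXmean hXlc hXeig hYind hY heind he heX
    𝒜 h𝒜 K V hKV hfin hncard α hα hα1
  have hn0 : n ≠ 0 := by omega
  have hnpos : (0 : ℝ) < n := by positivity
  have hp1 : (1 : ℝ) ≤ p := by exact_mod_cast (by omega : 1 ≤ p)
  set L := Real.log ((p : ℝ) * n) with hLdef
  set l := Real.log (1 / α) with hldef
  have hpn : (0 : ℝ) < p * n := by positivity
  have hpn12 : (12 : ℝ) ≤ p * n := by
    have h1 : (3 : ℝ) ≤ p := by exact_mod_cast hp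
    have h2 : (4 : ℝ) ≤ n := by exact_mod_cast hn
    nlinarith
  have hexpL : Real.exp L = p * n := Real.exp_log hpn
  have hL1 : 1 ≤ L := by
    rw [hLdef, Real.le_log_iff_exp_le hpn]
    linarith [Real.exp_one_lt_d9]
  have hl1 : 1 ≤ l := by
    rw [hldef, one_div, Real.log_inv]
    have := (Real.log_lt_iff_lt_exp hα).2 hα1
    linarith
  have hαl : Real.exp (-l) = α := by
    rw [hldef, one_div, Real.log_inv, neg_neg, Real.exp_log hα]
  have hrpow : ((p : ℝ) * n) ^ d = Real.exp (d * L) := by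
    rw [Real.rpow_def_of_pos hpn, mul_comm]
  -- roots of the parameters
  obtain ⟨x, hx0, hx⟩ : ∃ x : ℝ, 0 < x ∧ (n : ℝ) = x ^ 6 :=
    ⟨(n : ℝ) ^ (1 / 6 : ℝ), by positivity, by
      rw [← Real.rpow_natCast, ← Real.rpow_mul hnpos.le]; norm_num⟩
  obtain ⟨y, hy0, hy⟩ : ∃ y : ℝ, 0 < y ∧ L = y ^ 6 :=
    ⟨L ^ (1 / 6 : ℝ), by positivity, by
      rw [← Real.rpow_natCast, ← Real.rpow_mul (by linarith)]; norm_num⟩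
  obtain ⟨z, hz0, hz⟩ : ∃ z : ℝ, 0 < z ∧ l = z ^ 3 :=
    ⟨l ^ (1 / 3 : ℝ), by positivity, by
      rw [← Real.rpow_natCast, ← Real.rpow_mul (by linarith)]; norm_num⟩
  have hR (C : ℝ) : C * (n : ℝ) ^ (-(1 / 6) : ℝ) * L ^ (5 / 6 : ℝ) * l ^ (1 / 3 : ℝ) =
      C * (x⁻¹ * y ^ 5 * z) := by
    have e1 : (n : ℝ) ^ (-(1 / 6) : ℝ) = x⁻¹ := by
      rw [hx, Real.rpow_neg (by positivity), ← Real.rpow_natCast, ← Real.rpow_mul hx0.le]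
      norm_num
    have e2 : L ^ (5 / 6 : ℝ) = y ^ 5 := by
      rw [hy, ← Real.rpow_natCast, ← Real.rpow_mul hy0.le, ← Real.rpow_natCast]
      norm_num
    have e3 : l ^ (1 / 3 : ℝ) = z := by
      rw [hz, ← Real.rpow_natCast, ← Real.rpow_mul hz0.le]
      norm_num
    rw [e1, e2, e3]
    ring
  rw [hR]
  set R := x⁻¹ * y ^ 5 * z with hRdef
  have hR0 : 0 < R := by positivity
  have hx1 : 1 ≤ x := by
    by_contra! h
    have : x ^ 6 < 1 := pow_lt_one₀ hx0.le h (by norm_num)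
    have : (4 : ℝ) ≤ n := by exact_mod_cast hn
    linarith
  have hy1 : 1 ≤ y := by
    by_contra! h
    have : y ^ 6 < 1 := pow_lt_one₀ hy0.le h (by norm_num)
    linarith
  have hz1 : 1 ≤ z := by
    by_contra! h
    have : z ^ 3 < 1 := pow_lt_one₀ hz0.le h (by norm_num)
    linarith
  -- The dichotomy is `D R³ > 1` or `D R³ ≤ 1`. In the first case `D R ≥ 1`, since `D ≥ 1`, and the
  -- bound is trivial; the second is exactly `D L² l ≤ 1/lam`, which the tail estimate requires.
  rcases lt_or_ge (x ^ 3) (D * (y ^ 15 * z ^ 3)) with hreg | hreg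
  · refine ⟨Set.univ, MeasurableSet.univ, ?_, fun ω _ => ?_⟩
    · rw [measure_univ]
      exact ENNReal.ofReal_le_one.2 (by linarith)
    · have hone : 1 ≤ D * R := by
        have h1 : x ^ 3 < (D * (y ^ 5 * z)) ^ 3 := by
          have : D ≤ D ^ 3 := le_self_pow₀ hD1 (by norm_num)
          calc x ^ 3 < D * (y ^ 15 * z ^ 3) := hreg
            _ ≤ D ^ 3 * (y ^ 15 * z ^ 3) := by gcongr
            _ = _ := by ring
        have h2 := lt_of_pow_lt_pow_left₀ 3 (by positivity) h1
        have : D * R = D * (y ^ 5 * z) / x := by rw [hRdef]; field_simp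
        rw [this, one_le_div hx0]
        exact h2.le
      have hrest : 0 ≤ ((d + 1 + a) * κ + 4 * smoothIndicatorBound * C₁) * R := by positivity
      refine Real.iSup_le (fun A => ?_) (by positivity)
      refine le_trans ?_ (by linarith : (1 : ℝ) ≤ _)
      rw [abs_sub_le_iff]
      have h1 := measureReal_le_one (μ := condDistrib (bootstrapSum X e) (fun ω i => X i ω) P
        (fun i => X i ω)) (s := (A : Set (EuclideanSpace ℝ (Fin p))))
      have h2 := measureReal_le_one (μ := P') (s := {ω' | normalizedSum Y ω' ∈ A.1})
      have h3 := measureReal_nonneg (μ := condDistrib (bootstrapSum X e) (fun ω i => X i ω) P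
        (fun i => X i ω)) (s := (A : Set (EuclideanSpace ℝ (Fin p))))
      have h4 := measureReal_nonneg (μ := P') (s := {ω' | normalizedSum Y ω' ∈ A.1})
      constructor <;> linarith
  -- This is `√(L/n)`, so that `n lam² = L` is of the order of the logarithm of the number of pairs
  -- in the union bound.
  · set lam := y ^ 3 / x ^ 3 with hlam
    have hlam0 : 0 < lam := by positivity
    have hlaminv : D * (L ^ 2 * l) ≤ lam⁻¹ := by
      rw [hlam, inv_div, le_div_iff₀ (by positivity), hy, hz]
      calc _ = D * (y ^ 15 * z ^ 3) := by ring
        _ ≤ _ := hreg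
    have hLl : 1 ≤ L ^ 2 * l := one_le_mul_of_one_le_of_one_le (one_le_pow₀ hL1) hl1
    have hDlam : D ≤ lam⁻¹ := (le_mul_of_one_le_right (by linarith) hLl).trans hlaminv
    have hlam1 : lam ≤ 1 := (one_le_inv₀ hlam0).1 (hD1.trans hDlam)
    have hlamc : lam ≤ c / 2 := by
      rw [← inv_div, le_inv_comm₀ hlam0 (by positivity)]
      exact hDc'.trans hDlam
    set t := C₁ * lam * l with ht
    have ht0 : 0 ≤ t := by positivity
    have ht1 : t ≤ 1 := by
      have h1 : C₁ * l ≤ lam⁻¹ := by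
        refine le_trans ?_ hlaminv
        have : l ≤ L ^ 2 * l := le_mul_of_one_le_left (by linarith) (one_le_pow₀ hL1)
        gcongr
      calc t = C₁ * l * lam := by rw [ht]; ring
        _ ≤ lam⁻¹ * lam := by gcongr
        _ = 1 := inv_mul_cancel₀ hlam0.ne'
    set 𝒱 := hfin.toFinset with h𝒱
    have hV𝒱 {A : Set (EuclideanSpace ℝ (Fin p))} (hA : A ∈ 𝒜) : V A ⊆ 𝒱 := by
      intro v hv
      rw [h𝒱, Set.Finite.mem_toFinset]
      exact Set.mem_biUnion hA hv
    have hnorm : ∀ u ∈ 𝒱, ‖u‖ = 1 := by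
      intro u hu
      rw [h𝒱, Set.Finite.mem_toFinset] at hu
      obtain ⟨A, hA, huA⟩ := Set.mem_iUnion₂.1 hu
      exact (hKV A hA).generated.norm_eq_one u huA
    have h𝒱card : (𝒱.card : ℝ) ≤ Real.exp (d * L) := by
      rw [← hrpow]
      rwa [Set.ncard_eq_toFinset_card _ hfin] at hncard
    have hsec (i : Fin n) {u : EuclideanSpace ℝ (Fin p)} (hu : ‖u‖ = 1) :=
      integral_inner_sq_mem_of_eigenvalues (hX2 i) (hXeig i) hu
    have hXm0 (i : Fin n) (u : EuclideanSpace ℝ (Fin p)) : ∫ ω, ⟪u, X i ω⟫ ∂P = 0 := by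
      rw [integral_inner ((hX2 i).integrable (by norm_num)), hXmean, inner_zero_right]
    have hexp (i : Fin n) : ∀ u ∈ 𝒱, HasExpMoment P (fun ω => ⟪u, X i ω⟫) c M := by
      intro u hu
      have h := hasExpMoment_of_isLogConcave (hXm i) (hX2 i) (hXlc i) hk₂0
        (hsec i (hnorm u hu)).2
      exact ⟨h.measurable, h.integrable, h.integral_le.trans (le_max_left _ _)⟩
    have hprob : P.real (empiricalMomentEvent P X 𝒱 t)ᶜ ≤ α := by
      refine (measureReal_compl_empiricalMomentEvent_le hXind hXm0 hc0 hexp (le_max_right _ _)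
        hlam0 hlam1 hlamc t).trans ?_
      rw [← hαl]
      refine tail_sum_le_exp_neg (D := D) (L := L) (d := d) ?_
        (Nat.cast_nonneg _) h𝒱card hd hc0 hM1 ?_ hL1 hl1 hDM hlam0 hlaminv ?_ ?_
      · rw [hexpL]
        exact le_mul_of_one_le_left hnpos.le hp1
      · positivity
      · rw [hx, hy, hlam]
        field_simp
      · rw [ht, hC₁, momentConst]
    have hae := condDistrib_bootstrapSum hXm (fun i => (he i).aemeasurable) heX
    -- The conditional law is Gaussian only almost surely; a measurable null set is removed to keep
    -- the event measurable.
    obtain ⟨S, hSsub, hSm, hS0⟩ := exists_measurable_superset_of_null (ae_iff.1 hae)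
    have hEm := measurableSet_empiricalMomentEvent (P := P) hXm 𝒱 t
    refine ⟨empiricalMomentEvent P X 𝒱 t \ S, hEm.diff hSm, ?_, fun ω hω => ?_⟩
    · rw [measure_sdiff_null hS0, ← ofReal_measureReal]
      refine ENNReal.ofReal_le_ofReal ?_
      rw [probReal_compl_eq_one_sub hEm] at hprob
      linarith
    · have hcond : condDistrib (bootstrapSum X e) (fun ω i => X i ω) P (fun i => X i ω) =
          P.map (normalizedSum fun i ω' => e i ω' • (X i ω - sampleMean X ω)) := by
        by_contra h
        exact hω.2 (hSsub h)
      obtain ⟨hμG, hμ0, hμ2⟩ := gaussian_multiplierSum heind he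
        fun i => X i ω - sampleMean X ω
      rw [← hcond] at hμG hμ0 hμ2
      set μ := condDistrib (bootstrapSum X e) (fun ω i => X i ω) P (fun i => X i ω)
      have hYG (i : Fin n) : HasGaussianLaw (Y i) P' := (hY i).hasGaussianLaw
      have hY0 (i : Fin n) : ∫ ω, Y i ω ∂P' = 0 := by
        rw [(hY i).integral_eq, integral_id_multivariateGaussian]
      have hYS := hasGaussianLaw_normalizedSum hYG hYind
      set ν := P'.map (normalizedSum Y) with hνdef
      have : IsGaussian ν := hYS.isGaussian_map
      have hν0 : ∫ z, z ∂ν = 0 := integral_id_map_normalizedSum hYG hYind hY0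
      have hν2 (u v : EuclideanSpace ℝ (Fin p)) : ∫ z, ⟪u, z⟫ * ⟪v, z⟫ ∂ν =
          (n : ℝ)⁻¹ * ∑ i, ∫ ω, ⟪u, X i ω⟫ * ⟪v, X i ω⟫ ∂P := by
        rw [hνdef, integral_inner_mul_inner_map_normalizedSum hYG hYind hY0]
        simp_rw [integral_inner_mul_inner_of_hasLaw (hX2 _) (hY _)]
      have hνvar : ∀ v ∈ 𝒱, k₁ ≤ ∫ z, ⟪v, z⟫ ^ 2 ∂ν := by
        intro v hv
        simp_rw [sq]
        rw [hν2, le_inv_mul_iff₀ hnpos]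
        have h1 : ∀ i ∈ Finset.univ, k₁ ≤ ∫ ω, ⟪v, X i ω⟫ * ⟪v, X i ω⟫ ∂P := fun i _ => by
          simpa only [sq] using (hsec i (hnorm v hv)).1
        simpa using Finset.card_nsmul_le_sum _ _ _ h1
      have hΔ : ∀ u ∈ 𝒱, ∀ v ∈ 𝒱,
          |∫ z, ⟪u, z⟫ * ⟪v, z⟫ ∂μ - ∫ z, ⟪u, z⟫ * ⟪v, z⟫ ∂ν| ≤ 2 * t := by
        intro u hu v hv
        rw [hμ2, hν2]
        exact abs_bootstrap_covariance_sub_le hn0 ht1 hω.1 hu hv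
      -- The balance point of `√L/φ` and `φ² L · lam · l`: both equal `R`.
      set φ := x / (y ^ 2 * z) with hφ
      have hφ0 : 0 < φ := by positivity
      have hsqrtL : √L = y ^ 3 := by
        rw [hy, show y ^ 6 = (y ^ 3) ^ 2 by ring, Real.sqrt_sq (by positivity)]
      refine Real.iSup_le (fun A => ?_) (by positivity)
      have hA := A.2
      have hAm : MeasurableSet (A : Set (EuclideanSpace ℝ (Fin p))) := (h𝒜 hA).1
      have hνA : P'.real {ω' | normalizedSum Y ω' ∈ A.1} = ν.real A := by
        rw [measureReal_def, measureReal_def, hνdef,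
          Measure.map_apply_of_aemeasurable hYS.aemeasurable hAm]
        rfl
      rw [hνA]
      have hfinal := abs_gaussian_sub_le_of_isSimpleApprox ha hd (hKV A hA) hμ0 hν0 hk₁
        (fun v hv => hνvar v (hV𝒱 hA hv)) (by positivity : 0 ≤ 2 * t)
        (fun u hu v hv => hΔ u (hV𝒱 hA hu) v (hV𝒱 hA hv)) hL1
        (by rw [← hrpow]; exact (hKV A hA).card_le) hφ0
      refine hfinal.trans ?_
      rw [← hκ, hsqrtL]
      have e1 : (d + 1) / φ * (κ * y ^ 3) = (d + 1) * κ * R := by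
        rw [hφ, hRdef]; field_simp
      have e2 : a / n * (κ * y ^ 3) ≤ a * κ * R := by
        have h1 : y ^ 3 / n ≤ R := by
          rw [hx, hRdef]
          calc y ^ 3 / x ^ 6 ≤ y ^ 5 * z / x := by
                have h3 : y ^ 3 ≤ y ^ 5 := pow_le_pow_right₀ hy1 (by norm_num)
                have h4 : y ^ 5 ≤ y ^ 5 * z := le_mul_of_one_le_right (by positivity) hz1
                have h5 : x ≤ x ^ 6 := le_self_pow₀ hx1 (by norm_num)
                gcongr
                exact h3.trans h4
            _ = _ := by field_simp
        calc a / n * (κ * y ^ 3) = a * κ * (y ^ 3 / n) := by ring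
          _ ≤ _ := by gcongr
      have e3 : 2 * smoothIndicatorBound * (φ ^ 2 * L) * (2 * t) =
          4 * smoothIndicatorBound * C₁ * R := by
        rw [ht, hlam, hφ, hRdef, hy, hz]; field_simp; ring
      have e4 : 0 ≤ D * R := by positivity
      rw [add_mul, e1, e3]
      linarith
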